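/- Let $A=({\boldsymbol a}_1,\dots,{\boldsymbol a}_n)$ be a $d\times n$ integer matrix whose columns generate the group $\mathbb{Z}^d$, let $\mathbb{N}A\subseteq\mathbb{Z}^d$ be the monoid generated by the columns, let $R_A=\mathbb{C}[\mathbb{N}A]=\bigoplus_{{\boldsymbol b}\in\mathbb{N}A}\mathbb{C}\,t^{\boldsymbol b}$ be its semigroup algebra, and let $D(R_A)$ be the ring of $\mathbb{C}$-linear differential operators on $R_A$ (in the sense of Grothendieck). For $j=1,\dots,d$ let $s_j=t_j\partial_j\in D(R_A)$ be the operator $t^{\boldsymbol b}\mapsto b_j t^{\boldsymbol b}$, and grade $D(R_A)$ by $\mathbb{Z}^d$ through $$D(R_A)_{\boldsymbol a}=\{P\in D(R_A) : [s_j,P]=a_jP \ \text{for } j=1,\dots,d\}.$$ For $\boldsymbol\alpha\in\mathbb{C}^d$ let $M(\boldsymbol\alpha)=D(R_A)/\sum_{j=1}^d D(R_A)(s_j-\alpha_j)$, and let $L(\boldsymbol\alpha)$ be its unique simple quotient, that is, the quotient of $M(\boldsymbol\alpha)$ by the sum of all its proper submodules. Let $\mathrm{Prim}(D(R_A))$ be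 the set of $\mathbb{Z}^d$-homogeneous primitive ideals of $D(R_A)$, that is, of the annihilators of the $\mathbb{Z}^d$-graded simple left $D(R_A)$-modules (the nonzero $\mathbb{Z}^d$-graded left modules whose only graded submodules are $0$ and the whole module). **Theorem.** One has $$\mathrm{Prim}(D(R_A))=\{\operatorname{Ann} L(\boldsymbol\alpha) : \boldsymbol\alpha\in\mathbb{C}^d\},$$ and this set is finite. -/

import Mathlib

namespace ToricDiffOp

/-! ### Rings of differential operators -/

section DiffOp

variable (k S : Type*) [CommRing k] [CommRing S] [Algebra k S]

/-- The `k`-linear differential operators of order at most `m` on the commutative `k`-algebra `S`: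
order at most `0` means commuting with all multiplications by elements of `S`, and order at most
`m + 1` means that all commutators with multiplications have order at most `m`. -/
def diffOpOrder : ℕ → Submodule k (Module.End k S)
  | 0 =>
    { carrier := {P | ∀ f : S, LinearMap.mulLeft k f * P - P * LinearMap.mulLeft k f = 0}
      zero_mem' := by intro f; simp
      add_mem' := by
        intro P Q hP hQ f
        have h : LinearMap.mulLeft k f * (P + Q) - (P + Q) * LinearMap.mulLeft k f =
            (LinearMap.mulLeft k f * P - P * LinearMap.mulLeft k f) +
              (LinearMap.mulLeft k f * Q - Q * LinearMap.mulLeft k f) := by noncomm_ring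
        rw [h, hP f, hQ f, add_zero]
      smul_mem' := by
        intro c P hP f
        rw [mul_smul_comm, smul_mul_assoc, ← smul_sub, hP f, smul_zero] }
  | m + 1 =>
    { carrier := {P | ∀ f : S,
        LinearMap.mulLeft k f * P - P * LinearMap.mulLeft k f ∈ diffOpOrder m}
      zero_mem' := by intro f; simp
      add_mem' := by
        intro P Q hP hQ f
        have h : LinearMap.mulLeft k f * (P + Q) - (P + Q) * LinearMap.mulLeft k f =
            (LinearMap.mulLeft k f * P - P * LinearMap.mulLeft k f) +
              (LinearMap.mulLeft k f * Q - Q * LinearMap.mulLeft k f) := by noncomm_ring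
        rw [h]
        exact add_mem (hP f) (hQ f)
      smul_mem' := by
        intro c P hP f
        rw [mul_smul_comm, smul_mul_assoc, ← smul_sub]
        exact Submodule.smul_mem _ c (hP f) }

variable {k S}

theorem mem_diffOpOrder_zero {P : Module.End k S} :
    P ∈ diffOpOrder k S 0 ↔
      ∀ f : S, LinearMap.mulLeft k f * P - P * LinearMap.mulLeft k f = 0 := Iff.rfl

theorem mem_diffOpOrder_succ {m : ℕ} {P : Module.End k S} :
    P ∈ diffOpOrder k S (m + 1) ↔
      ∀ f : S, LinearMap.mulLeft k f * P - P * LinearMap.mulLeft k f ∈ diffOpOrder k S m := Iff.rfl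

theorem diffOpOrder_le_succ (m : ℕ) : diffOpOrder k S m ≤ diffOpOrder k S (m + 1) := by
  induction m with
  | zero =>
    intro P hP f
    rw [mem_diffOpOrder_zero.1 hP f]
    exact zero_mem _
  | succ m ih =>
    intro P hP f
    exact ih (mem_diffOpOrder_succ.1 hP f)

theorem diffOpOrder_mono : Monotone (diffOpOrder k S) :=
  monotone_nat_of_le_succ diffOpOrder_le_succ

theorem algebraMap_mem_diffOpOrder (c : k) :
    algebraMap k (Module.End k S) c ∈ diffOpOrder k S 0 := by
  intro f
  rw [Algebra.commutes, sub_self]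

theorem mul_mem_diffOpOrder (i j : ℕ) {P Q : Module.End k S}
    (hP : P ∈ diffOpOrder k S i) (hQ : Q ∈ diffOpOrder k S j) :
    P * Q ∈ diffOpOrder k S (i + j) := by
  have key : ∀ (P Q : Module.End k S) (f : S),
      LinearMap.mulLeft k f * (P * Q) - P * Q * LinearMap.mulLeft k f =
        (LinearMap.mulLeft k f * P - P * LinearMap.mulLeft k f) * Q +
          P * (LinearMap.mulLeft k f * Q - Q * LinearMap.mulLeft k f) := by
    intro P Q f
    rw [sub_mul, mul_sub]
    simp only [mul_assoc]
    abel
  induction hn : i + j generalizing i j P Q with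
  | zero =>
    obtain ⟨rfl, rfl⟩ : i = 0 ∧ j = 0 := by omega
    intro f
    rw [key, mem_diffOpOrder_zero.1 hP f, mem_diffOpOrder_zero.1 hQ f, zero_mul, mul_zero,
      add_zero]
  | succ n ih =>
    intro f
    rw [key]
    refine add_mem ?_ ?_
    · cases i with
      | zero =>
        rw [mem_diffOpOrder_zero.1 hP f, zero_mul]
        exact zero_mem _
      | succ i => exact ih i j (mem_diffOpOrder_succ.1 hP f) hQ (by omega)
    · cases j with
      | zero =>
        rw [mem_diffOpOrder_zero.1 hQ f, mul_zero]
        exact zero_mem _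
      | succ j => exact ih i j hP (mem_diffOpOrder_succ.1 hQ f) (by omega)

variable (k S) in
/-- The ring `D(S)` of `k`-linear differential operators on the commutative `k`-algebra `S`. -/
def DiffOp : Subalgebra k (Module.End k S) where
  carrier := {P | ∃ m, P ∈ diffOpOrder k S m}
  mul_mem' := by
    rintro P Q ⟨i, hP⟩ ⟨j, hQ⟩
    exact ⟨i + j, mul_mem_diffOpOrder i j hP hQ⟩
  add_mem' := by
    rintro P Q ⟨i, hP⟩ ⟨j, hQ⟩
    exact ⟨max i j, add_mem (diffOpOrder_mono (le_max_left i j) hP)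
      (diffOpOrder_mono (le_max_right i j) hQ)⟩
  algebraMap_mem' c := ⟨0, algebraMap_mem_diffOpOrder c⟩

end DiffOp

/-! ### The semigroup algebra and its ring of differential operators -/

section Toric

variable {d n : ℕ} (A : Fin n → Fin d → ℤ)

/-- The monoid `ℕA` generated by the columns `A 0, …, A (n - 1)`. -/
abbrev NA : AddSubmonoid (Fin d → ℤ) := AddSubmonoid.closure (Set.range A)

/-- The semigroup algebra `R_A = ℂ[ℕA]`; the monomial `t ^ b` is `AddMonoidAlgebra.single b 1`. -/
abbrev RA : Type := AddMonoidAlgebra ℂ (NA A)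

/-- The ring `D(R_A)` of differential operators on `R_A`. -/
def DRA : Type := DiffOp ℂ (RA A)

noncomputable instance : Ring (DRA A) := inferInstanceAs (Ring (DiffOp ℂ (RA A)))

noncomputable instance : Algebra ℂ (DRA A) := inferInstanceAs (Algebra ℂ (DiffOp ℂ (RA A)))

/-- The Euler operator `t_j ∂_j` as a linear map on `R_A`: it sends `t ^ b` to `b_j t ^ b`. -/
noncomputable def eulerMap (j : Fin d) : Module.End ℂ (RA A) :=
  (Finsupp.lsum ℂ fun b : NA A =>
      (((b : Fin d → ℤ) j : ℤ) : ℂ) • AddMonoidAlgebra.lsingle (R := ℂ) (S := ℂ) b) ∘ₗ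
    (AddMonoidAlgebra.coeffLinearEquiv ℂ).toLinearMap

theorem eulerMap_single (j : Fin d) (b : NA A) (c : ℂ) :
    eulerMap A j (AddMonoidAlgebra.single b c) =
      AddMonoidAlgebra.single b ((((b : Fin d → ℤ) j : ℤ) : ℂ) * c) := by
  simp [eulerMap, AddMonoidAlgebra.coeff_single]

theorem eulerMap_mul (j : Fin d) (f g : RA A) :
    eulerMap A j (f * g) = eulerMap A j f * g + f * eulerMap A j g := by
  induction f using AddMonoidAlgebra.induction_linear with
  | zero => simp
  | add f₁ f₂ h₁ h₂ =>
    rw [add_mul, map_add, h₁, h₂, map_add, add_mul, add_mul]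
    abel
  | single a x =>
    induction g using AddMonoidAlgebra.induction_linear with
    | zero => simp
    | add g₁ g₂ h₁ h₂ =>
      rw [mul_add, map_add, h₁, h₂, map_add, mul_add, mul_add]
      abel
    | single b y =>
      simp only [AddMonoidAlgebra.single_mul_single, eulerMap_single]
      rw [← AddMonoidAlgebra.single_add]
      congr 1
      push_cast [AddSubmonoid.coe_add, Pi.add_apply]
      ring

theorem eulerMap_mem (j : Fin d) : eulerMap A j ∈ DiffOp ℂ (RA A) := by
  refine ⟨1, fun f => ?_⟩
  have h : LinearMap.mulLeft ℂ f * eulerMap A j - eulerMap A j * LinearMap.mulLeft ℂ f =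
      -LinearMap.mulLeft ℂ (eulerMap A j f) := by
    refine LinearMap.ext fun g => ?_
    simp [eulerMap_mul]
  rw [h]
  intro g
  refine LinearMap.ext fun x => ?_
  simp [mul_left_comm]

/-- The Euler operator `s_j = t_j ∂_j` as an element of `D(R_A)`. -/
noncomputable def s (j : Fin d) : DRA A := ⟨eulerMap A j, eulerMap_mem A j⟩

/-- The degree `a` component `D(R_A)_a = {P | [s_j, P] = a_j P for all j}` of `D(R_A)`. -/
noncomputable def gradedPiece (a : Fin d → ℤ) : Submodule ℂ (DRA A) where
  carrier := {P | ∀ j, s A j * P - P * s A j = ((a j : ℤ) : ℂ) • P}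
  zero_mem' := by intro j; simp
  add_mem' := by
    intro P Q hP hQ j
    have h : s A j * (P + Q) - (P + Q) * s A j =
        (s A j * P - P * s A j) + (s A j * Q - Q * s A j) := by noncomm_ring
    rw [h, hP j, hQ j, smul_add]
  smul_mem' := by
    intro c P hP j
    rw [mul_smul_comm, smul_mul_assoc, ← smul_sub, hP j, smul_comm]

/-! ### The modules `M(α)` and `L(α)` -/

/-- The left ideal `D(R_A)(s - α)`, generated by all `s_j - α_j`. -/
noncomputable def relations (α : Fin d → ℂ) : Submodule (DRA A) (DRA A) :=
  Submodule.span (DRA A) (Set.range fun j => s A j - algebraMap ℂ (DRA A) (α j))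

/-- The left module `M(α) = D(R_A) / D(R_A)(s - α)`. -/
abbrev M (α : Fin d → ℂ) : Type := DRA A ⧸ relations A α

/-- The sum of all proper submodules of `M(α)`; as `M(α)` has a unique simple quotient,
this is its unique maximal submodule. -/
noncomputable def maxSubmodule (α : Fin d → ℂ) : Submodule (DRA A) (M A α) :=
  sSup {N | N ≠ ⊤}

/-- The unique simple quotient `L(α)` of `M(α)`. -/
abbrev L (α : Fin d → ℂ) : Type := M A α ⧸ maxSubmodule A α

/-! ### Homogeneous primitive ideals -/

/-- The family `𝓜` makes the left `D(R_A)`-module `N` into a `ℤ^d`-graded simple module: `N` is the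
direct sum of the `𝓜 b`, the grading is compatible with that of `D(R_A)`, `N` is nonzero, and
its only graded submodules are `0` and `N`. -/
structure IsGradedSimple (N : Type) [AddCommGroup N] [Module (DRA A) N]
    (𝓜 : (Fin d → ℤ) → AddSubgroup N) : Prop where
  isInternal : DirectSum.IsInternal 𝓜
  smul_mem : ∀ (a b : Fin d → ℤ) (P : DRA A) (x : N),
    P ∈ gradedPiece A a → x ∈ 𝓜 b → P • x ∈ 𝓜 (a + b)
  nontrivial : Nontrivial N
  eq_bot_or_eq_top : ∀ W : Submodule (DRA A) N,
    W.toAddSubgroup = (⨆ b, W.toAddSubgroup ⊓ 𝓜 b) → W = ⊥ ∨ W = ⊤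

/-- The set `Prim(D(R_A))` of `ℤ^d`-homogeneous primitive ideals of `D(R_A)`, that is, of the
annihilators of the `ℤ^d`-graded simple left `D(R_A)`-modules. -/
def Prim : Set (Ideal (DRA A)) :=
  {I | ∃ (N : Type) (_ : AddCommGroup N) (_ : Module (DRA A) N)
    (𝓜 : (Fin d → ℤ) → AddSubgroup N),
    IsGradedSimple A N 𝓜 ∧ I = Module.annihilator (DRA A) N}

end Toric

end ToricDiffOp

/-!
Every operator `P ∈ D(R_A)` is described by its symbols: for `a ∈ ℤ^d` there is a polynomial
`σ_a(P)` in `d` variables with `P(t ^ b) = ∑ a, σ_a(P)(b) t ^ (a + b)` for `b ∈ ℕA`. It exists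
because the coefficient functions on `ℕA` are killed by high differences
(`HasDiffOrder.exists_eval_eq`). Conversely `t ^ a p(s)` is in `D(R_A)` as soon as `p` vanishes on
`{b ∈ ℕA | a + b ∉ ℕA}` (`mkOp`). As only finitely many symbols of `P` are nonzero
(`finite_coef`), `D(R_A)` is the direct sum of its graded pieces, and the piece of degree `0` is
the polynomial ring in the Euler operators.

Annihilators. The left ideal `maxIdeal α = {P | σ_0(QP)(α) = 0 for all Q}` is the largest proper
left ideal containing all `s_j - α_j`, so `L(α) = D(R_A) / maxIdeal α`, graded by weights. In a
graded simple module, the degree `0` part of `D(R_A)` acts irreducibly on each component, so by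
the Nullstellensatz a nonzero homogeneous vector `x` has some weight `α`; by graded simplicity the
annihilator of `x` is `maxIdeal α` (`exists_annihilator_eq`). This is the first assertion.

Finiteness. For a set `τ` of columns, not necessarily a face, let `E_τ(α) = {λ ∈ ℂτ | α - λ ∈ ℕA +
ℤτ}`. By Dickson's lemma `{x ∈ ℕA | x + b ∉ ℕA}` is a finite union of sets `x + ℕτ`, whence some
operator of degree `b` has a symbol which is nonzero at `α` if and only if `E_τ(α) ⊆ E_τ(α + b)`
for all `τ` (`E_subset_of_exists`, `exists_of_E_subset`). It follows that `P` annihilates `L(α)`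
if and only if each `σ_a(P)` vanishes at the points `α + b` with `E(α) ⊆ E(α + b)` and `E(α + b +
a) ⊆ E(α)` (`mem_annihilator_L_iff`).

Let `T` be the set of all `τ` with `α ∈ ℤ^d + ℂτ`. The set of these points `α + b` is invariant
under the lattice `⋂_{τ ∈ T} ℤτ`, which is Zariski dense in `⋂_{τ ∈ T} ℂτ` by rationality
(`spanInf_le_span_latticeInf`). So the annihilator is unchanged when `α` moves by an element of
`⋂_{τ ∈ T} ℂτ` without changing `T` (`annihilator_L_add_spanInf`), or by an element of `ℤ^d`
without changing `E(α)` (`annihilator_L_add_castC`). For each of the finitely many `T`, the `α` in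
question form finitely many classes modulo `ℤ^d + ⋂_{τ ∈ T} ℂτ`, since these classes are torsion
elements of a finitely generated group; and on a coset `α + ℤ^d` the function `E` takes finitely
many values (`finite_range_E`).
-/

namespace ToricDiffOp

/-! ### Polynomials and finite differences -/

section Polynomials

open MvPolynomial

variable {d : ℕ}

/-- The polynomial `p` with the variables translated by `b`. -/
noncomputable def shift (b : Fin d → ℂ) : MvPolynomial (Fin d) ℂ →ₐ[ℂ] MvPolynomial (Fin d) ℂ :=
  aeval fun j => X j + C (b j)

theorem eval_shift (b x : Fin d → ℂ) (p : MvPolynomial (Fin d) ℂ) :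
    eval x (shift b p) = eval (x + b) p := by
  induction p using MvPolynomial.induction_on with
  | C c => simp [shift]
  | add p q hp hq => simp [hp, hq]
  | mul_X p j hp => rw [map_mul, map_mul, hp]; simp [shift]

/-- A polynomial vanishing at all natural points of a line vanishes on the line. -/
theorem eval_add_smul_eq_zero {p : MvPolynomial (Fin d) ℂ} {x v : Fin d → ℂ}
    (h : ∀ k : ℕ, eval (x + (k : ℂ) • v) p = 0) (c : ℂ) : eval (x + c • v) p = 0 := by
  set q : Polynomial ℂ := aeval (fun j => Polynomial.C (x j) + Polynomial.X * Polynomial.C (v j)) p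
    with hq
  have key : ∀ c : ℂ, q.eval c = eval (x + c • v) p := by
    intro c
    rw [hq]
    clear hq h q
    induction p using MvPolynomial.induction_on with
    | C c => simp
    | add p q hp hq => rw [map_add, Polynomial.eval_add, hp, hq, map_add]
    | mul_X p j hp => rw [map_mul, Polynomial.eval_mul, hp, map_mul]; simp [mul_comm c]
  have h0 : q = 0 := by
    refine Polynomial.eq_zero_of_infinite_isRoot q ?_
    refine Set.infinite_of_injective_forall_mem (f := fun k : ℕ => (k : ℂ)) Nat.cast_injective ?_
    intro k
    simp [key, h]
  rw [← key, h0, Polynomial.eval_zero]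

/-- A polynomial vanishing on a translate of a submonoid of `ℂ^d` vanishes on the corresponding
translate of the complex span of the submonoid. -/
theorem eval_add_eq_zero_of_mem_span (N : AddSubmonoid (Fin d → ℂ)) {p : MvPolynomial (Fin d) ℂ}
    {x : Fin d → ℂ} (h : ∀ v ∈ N, eval (x + v) p = 0) {y : Fin d → ℂ}
    (hy : y ∈ Submodule.span ℂ (N : Set (Fin d → ℂ))) : eval (x + y) p = 0 := by
  suffices H : ∀ z, (∀ v ∈ N, eval (z + v) p = 0) → ∀ v ∈ N, eval (z + y + v) p = 0 by
    simpa using H x h 0 N.zero_mem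
  clear h
  induction hy using Submodule.closure_induction with
  | zero => intro z h v hv; simpa using h v hv
  | add y₁ y₂ _ _ h₁ h₂ =>
    intro z h v hv
    rw [← add_assoc]
    exact h₂ _ (h₁ _ h) v hv
  | smul_mem c w hw =>
    intro z h v hv
    rw [add_right_comm]
    refine eval_add_smul_eq_zero (fun k => ?_) c
    rw [add_assoc]
    refine h _ (N.add_mem hv ?_)
    rw [Nat.cast_smul_eq_nsmul]
    exact N.nsmul_mem hw k

/-- The coordinatewise embedding `ℤ^d → ℂ^d`. -/
def castC : (Fin d → ℤ) →+ (Fin d → ℂ) := (Int.castAddHom ℂ).compLeft (Fin d)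

@[simp] theorem castC_apply (x : Fin d → ℤ) (j : Fin d) : castC x j = (x j : ℂ) := rfl

theorem castC_injective : Function.Injective (castC (d := d)) := by
  intro x y h
  funext j
  have := congrFun h j
  simpa using this

theorem exists_eval_eq_one_of_notMem {x : Fin d → ℂ} (F : Finset (Fin d → ℂ)) (h : x ∉ F) :
    ∃ p : MvPolynomial (Fin d) ℂ, eval x p = 1 ∧ ∀ y ∈ F, eval y p = 0 := by
  induction F using Finset.induction_on with
  | empty => exact ⟨1, by simp⟩
  | insert y F hy ih =>
    simp only [Finset.mem_insert, not_or] at h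
    obtain ⟨p, hp, hF⟩ := ih h.2
    obtain ⟨j, hj⟩ := Function.ne_iff.1 h.1
    refine ⟨p * (C (x j - y j)⁻¹ * (X j - C (y j))), ?_, ?_⟩
    · simp [hp, inv_mul_cancel₀ (sub_ne_zero.2 hj)]
    · intro z hz
      rcases Finset.mem_insert.1 hz with rfl | hz
      · simp
      · simp [hF z hz]

end Polynomials

section Differences

variable {Mo : Type*} [AddCommMonoid Mo]

/-- The function `f` on a commutative monoid is annihilated by all `(m + 1)`-fold differences. -/
def HasDiffOrder : ℕ → (Mo → ℂ) → Prop
  | 0, f => ∀ c, fwdDiff c f = 0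
  | m + 1, f => ∀ c, HasDiffOrder m (fwdDiff c f)

theorem hasDiffOrder_zero (m : ℕ) : HasDiffOrder m (0 : Mo → ℂ) := by
  induction m with
  | zero => intro c; funext x; simp [fwdDiff]
  | succ m ih =>
    intro c
    have : fwdDiff c (0 : Mo → ℂ) = 0 := by funext x; simp [fwdDiff]
    rw [this]; exact ih

theorem HasDiffOrder.fwdDiff {m : ℕ} {f : Mo → ℂ} (hf : HasDiffOrder m f) (c : Mo) :
    HasDiffOrder m (fwdDiff c f) := by
  induction m generalizing f c with
  | zero => rw [hf c]; exact hasDiffOrder_zero 0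
  | succ m ih => intro c'; exact ih (hf c) c'

theorem HasDiffOrder.fwdDiff_iter {m : ℕ} {f : Mo → ℂ} (hf : HasDiffOrder m f) (c : Mo) (k : ℕ) :
    HasDiffOrder m ((_root_.fwdDiff c)^[k] f) := by
  induction k generalizing f with
  | zero => exact hf
  | succ k ih => exact ih (hf.fwdDiff c)

theorem HasDiffOrder.fwdDiff_iter_eq_zero {m : ℕ} {f : Mo → ℂ} (hf : HasDiffOrder m f) (c : Mo)
    {k : ℕ} (hk : m < k) : (_root_.fwdDiff c)^[k] f = 0 := by
  have h0 : ∀ k, (_root_.fwdDiff c)^[k] (0 : Mo → ℂ) = 0 := by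
    intro k
    refine Function.iterate_fixed ?_ k
    funext x; simp [_root_.fwdDiff]
  induction m generalizing f k with
  | zero =>
    obtain ⟨k, rfl⟩ := Nat.exists_eq_succ_of_ne_zero hk.ne'
    rw [Function.iterate_succ_apply, hf c, h0]
  | succ m ih =>
    obtain ⟨k, rfl⟩ := Nat.exists_eq_succ_of_ne_zero (Nat.zero_lt_of_lt hk).ne'
    rw [Function.iterate_succ_apply]
    exact ih (hf c) (by omega)

/-- Newton's formula: a function killed by high differences is polynomial in the exponents of any
finite family of elements. -/
theorem HasDiffOrder.exists_polynomial {ι : Type*} [DecidableEq ι] (a : ι → Mo) (s : Finset ι)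
    {m : ℕ} {f : Mo → ℂ} (hf : HasDiffOrder m f) (x : Mo) :
    ∃ P : MvPolynomial ι ℂ, ∀ u : ι → ℕ,
      f (x + ∑ i ∈ s, u i • a i) = MvPolynomial.eval (fun i => (u i : ℂ)) P := by
  induction s using Finset.induction_on generalizing f with
  | empty => exact ⟨MvPolynomial.C (f x), by simp⟩
  | insert j s hj ih =>
    choose P hP using fun k => ih (hf.fwdDiff_iter (a j) k)
    refine ⟨∑ k ∈ Finset.range (m + 1),
      MvPolynomial.C ((k.factorial : ℂ)⁻¹) *
        Polynomial.aeval (MvPolynomial.X j) (descPochhammer ℂ k) * P k, fun u => ?_⟩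
    have hch : ∀ k : ℕ, MvPolynomial.eval (fun i => (u i : ℂ))
        (Polynomial.aeval (MvPolynomial.X j : MvPolynomial ι ℂ) (descPochhammer ℂ k)) =
          (descPochhammer ℂ k).eval (u j : ℂ) := by
      intro k
      rw [← MvPolynomial.coe_aeval_eq_eval, RingHom.coe_coe, ← Polynomial.aeval_algHom_apply]
      simp
    rw [Finset.sum_insert hj, add_left_comm, add_comm, shift_eq_sum_fwdDiff_iter (a j) f, map_sum]
    have hterm : ∀ k : ℕ, (u j).choose k • (_root_.fwdDiff (a j))^[k] f (x + ∑ i ∈ s, u i • a i) =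
        MvPolynomial.eval (fun i => (u i : ℂ)) (MvPolynomial.C ((k.factorial : ℂ)⁻¹) *
        Polynomial.aeval (MvPolynomial.X j) (descPochhammer ℂ k) * P k) := by
      intro k
      rw [hP, map_mul, map_mul, hch, MvPolynomial.eval_C, nsmul_eq_mul,
        Nat.cast_choose_eq_descPochhammer_div]
      ring
    simp only [hterm]
    -- both sums may be extended to `range (u j + m + 1)`: binomials or differences vanish beyond
    trans ∑ k ∈ Finset.range (u j + m + 1), MvPolynomial.eval (fun i => (u i : ℂ))
      (MvPolynomial.C ((k.factorial : ℂ)⁻¹) *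
        Polynomial.aeval (MvPolynomial.X j) (descPochhammer ℂ k) * P k)
    · refine Finset.sum_subset (fun k hk => ?_) fun k _ hk => ?_
      · simp only [Finset.mem_range] at *; omega
      · simp only [Finset.mem_range, not_lt] at hk
        rw [← hterm, Nat.choose_eq_zero_of_lt (by omega), zero_smul]
    · refine (Finset.sum_subset (fun k hk => ?_) fun k _ hk => ?_).symm
      · simp only [Finset.mem_range] at *; omega
      · simp only [Finset.mem_range, not_lt] at hk
        rw [← hterm, hf.fwdDiff_iter_eq_zero (a j) (by omega)]
        simp

end Differences

section NAPolynomials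

open MvPolynomial

variable {d n : ℕ} (A : Fin n → Fin d → ℤ)

theorem exists_nat_of_mem_NA {x : Fin d → ℤ} (hx : x ∈ NA A) :
    ∃ u : Fin n → ℕ, x = ∑ i, u i • A i := by
  obtain ⟨u, hu⟩ := AddSubmonoid.mem_closure_range_iff_of_fintype.1 hx
  exact ⟨u, hu⟩

/-- The `i`-th generator of `ℕA`. -/
def gen (i : Fin n) : NA A := ⟨A i, AddSubmonoid.subset_closure ⟨i, rfl⟩⟩

theorem coe_sum_gen (u : Fin n → ℕ) :
    ((∑ i, u i • gen A i : NA A) : Fin d → ℤ) = ∑ i, u i • A i := by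
  rw [AddSubmonoid.coe_finsetSum]; rfl

theorem sum_smul_mem_NA (u : Fin n → ℕ) : ∑ i, u i • A i ∈ NA A :=
  sum_mem fun i _ => nsmul_mem (AddSubmonoid.subset_closure (Set.mem_range_self i)) _

variable {A}

theorem exists_int_of_closure_eq_top (hA : AddSubgroup.closure (Set.range A) = ⊤)
    (x : Fin d → ℤ) : ∃ c : Fin n → ℤ, x = ∑ i, c i • A i := by
  have hx : x ∈ AddSubgroup.closure (Set.range A) := hA ▸ AddSubgroup.mem_top x
  exact AddSubgroup.mem_closure_range_iff_of_fintype.1 hx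

/-- A function on `ℕA` annihilated by high differences is the restriction of a polynomial: it is
polynomial in the exponents of the generators, and this polynomial is invariant under the integer
relations among the generators, so that it can be pulled back along an integral section. -/
theorem HasDiffOrder.exists_eval_eq (hA : AddSubgroup.closure (Set.range A) = ⊤)
    {m : ℕ} {f : NA A → ℂ} (hf : HasDiffOrder m f) :
    ∃ p : MvPolynomial (Fin d) ℂ, ∀ b : NA A, eval (castC (b : Fin d → ℤ)) p = f b := by
  obtain ⟨P, hP⟩ := hf.exists_polynomial (gen A) Finset.univ 0
  simp only [zero_add] at hP
  choose c hc using fun j : Fin d => exists_int_of_closure_eq_top hA (Pi.single j 1)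
  refine ⟨aeval (fun i => ∑ j, C (c j i : ℂ) * X j) P, fun b => ?_⟩
  obtain ⟨u, hu⟩ := exists_nat_of_mem_NA A b.2
  -- `u` and `u + k` are two systems of integral exponents for `b`, the second linear in `b`
  set k : Fin n → ℤ := fun i => ∑ j, c j i * (b : Fin d → ℤ) j - u i with hk
  have hk0 : ∑ i, k i • A i = 0 := by
    have : ∑ i, (∑ j, c j i * (b : Fin d → ℤ) j) • A i = (b : Fin d → ℤ) := by
      simp only [Finset.sum_smul]
      rw [Finset.sum_comm]
      simp only [mul_comm (c _ _), mul_smul, ← Finset.smul_sum, ← hc]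
      funext j
      simp [Finset.sum_apply, Pi.single_apply]
    simp only [hk, sub_smul, Finset.sum_sub_distrib, this, natCast_zsmul, ← hu, sub_self]
  have hinv : shift (fun i => (k i : ℂ)) P = P := by
    refine funext_set (fun i => Set.range fun v : ℕ => ((v + (-k i).toNat : ℕ) : ℂ))
      (hs := fun i => (Set.infinite_range_of_injective fun v w h => by
        simpa using h)) fun x hx => ?_
    -- the shift by `(-k)⁺` makes both exponent vectors nonnegative
    choose v hv using fun i => hx i (Set.mem_univ i)
    obtain rfl := funext hv
    rw [eval_shift, ← hP]
    have h2 : ((fun i => ((v i + (-k i).toNat : ℕ) : ℂ)) + fun i => (k i : ℂ)) =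
        fun i => ((v i + (k i).toNat : ℕ) : ℂ) := by
      funext i
      have : ((v i + (-k i).toNat : ℕ) : ℤ) + k i = ((v i + (k i).toNat : ℕ) : ℤ) := by
        push_cast; omega
      have := congrArg (Int.cast : ℤ → ℂ) this
      rw [Int.cast_add, Int.cast_natCast, Int.cast_natCast] at this
      exact this
    rw [h2, ← hP]
    congr 1
    apply Subtype.ext
    rw [coe_sum_gen, coe_sum_gen]
    rw [← sub_eq_zero, ← Finset.sum_sub_distrib, ← hk0]
    refine Finset.sum_congr rfl fun i _ => ?_
    rw [← natCast_zsmul, ← natCast_zsmul, ← sub_smul]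
    congr 1
    push_cast
    omega
  have hb : (∑ i, u i • gen A i) = b := by
    apply Subtype.ext
    rw [coe_sum_gen, hu]
  have heval : ∀ Q : MvPolynomial (Fin n) ℂ, eval (castC (b : Fin d → ℤ))
      (aeval (fun i => ∑ j, C (c j i : ℂ) * X j) Q) =
        eval ((fun i => (u i : ℂ)) + fun i => (k i : ℂ)) Q := by
    intro Q
    induction Q using MvPolynomial.induction_on with
    | C c => simp
    | add p q hp hq => simp only [map_add, hp, hq]
    | mul_X p j hp => rw [map_mul, map_mul, hp, map_mul]; simp [hk]
  rw [heval, ← eval_shift, hinv, ← hP, hb]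

theorem span_castC_NA (hA : AddSubgroup.closure (Set.range A) = ⊤) :
    Submodule.span ℂ (((NA A).map (castC (d := d)) : AddSubmonoid (Fin d → ℂ)) :
      Set (Fin d → ℂ)) = ⊤ := by
  have h1 : ∀ x : Fin d → ℤ, castC x ∈ Submodule.span ℂ
      (((NA A).map (castC (d := d)) : AddSubmonoid (Fin d → ℂ)) : Set (Fin d → ℂ)) := by
    intro x
    obtain ⟨c, rfl⟩ := exists_int_of_closure_eq_top hA x
    rw [map_sum]
    refine sum_mem fun i _ => ?_
    rw [map_zsmul]
    exact zsmul_mem (Submodule.subset_span (AddSubmonoid.mem_map_of_mem _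
      (AddSubmonoid.subset_closure (Set.mem_range_self i)))) _
  rw [eq_top_iff]
  intro y _
  have hy : y = ∑ j, y j • castC (Pi.single j (1 : ℤ)) := by
    funext k
    simp [Pi.single_apply]
  rw [hy]
  exact sum_mem fun j _ => Submodule.smul_mem _ _ (h1 _)

/-- `ℕA` is Zariski dense in `ℂ^d`. -/
theorem eq_zero_of_forall_NA (hA : AddSubgroup.closure (Set.range A) = ⊤)
    {p : MvPolynomial (Fin d) ℂ} (h : ∀ b : NA A, eval (castC (b : Fin d → ℤ)) p = 0) : p = 0 := by
  refine MvPolynomial.funext fun y => ?_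
  have := eval_add_eq_zero_of_mem_span ((NA A).map (castC (d := d))) (p := p) (x := 0) (y := y)
    (by
      rintro _ ⟨b, hb, rfl⟩
      simpa using h ⟨b, hb⟩)
    (by rw [span_castC_NA hA]; trivial)
  simpa using this

theorem eq_of_forall_NA (hA : AddSubgroup.closure (Set.range A) = ⊤)
    {p q : MvPolynomial (Fin d) ℂ}
    (h : ∀ b : NA A, eval (castC (b : Fin d → ℤ)) p = eval (castC (b : Fin d → ℤ)) q) : p = q := by
  rw [← sub_eq_zero]
  exact eq_zero_of_forall_NA hA fun b => by rw [map_sub, h, sub_self]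

end NAPolynomials

/-! ### Symbols of differential operators -/

section Symbols

open MvPolynomial

variable {d n : ℕ} (A : Fin n → Fin d → ℤ)

/-- The ring of Laurent polynomials `ℂ[ℤ^d]`. -/
abbrev LZ (d : ℕ) : Type := AddMonoidAlgebra ℂ (Fin d → ℤ)

/-- The inclusion of `R_A` in the ring of Laurent polynomials. -/
noncomputable def toLZ : RA A →ₐ[ℂ] LZ d :=
  AddMonoidAlgebra.mapDomainAlgHom ℂ ℂ (NA A).subtype

@[simp] theorem toLZ_single (b : NA A) (c : ℂ) :
    toLZ A (AddMonoidAlgebra.single b c) = AddMonoidAlgebra.single (b : Fin d → ℤ) c :=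
  AddMonoidAlgebra.mapDomain_single

theorem toLZ_injective : Function.Injective (toLZ A) :=
  AddMonoidAlgebra.mapDomain_injective Subtype.val_injective

theorem coeff_toLZ_of_notMem {x : Fin d → ℤ} (hx : x ∉ NA A) (f : RA A) :
    (toLZ A f).coeff x = 0 := by
  induction f using AddMonoidAlgebra.induction_linear with
  | zero => simp
  | add f g hf hg => simp [hf, hg]
  | single b c =>
    have : (b : Fin d → ℤ) ≠ x := fun h => hx (h ▸ b.2)
    simp [this]

theorem ext_single {V : Type*} [AddCommGroup V] [Module ℂ V] {M : Type*}
    {f g : AddMonoidAlgebra ℂ M →ₗ[ℂ] V}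
    (h : ∀ b, f (AddMonoidAlgebra.single b 1) = g (AddMonoidAlgebra.single b 1)) : f = g := by
  refine LinearMap.ext fun x => ?_
  induction x using AddMonoidAlgebra.induction_linear with
  | zero => simp
  | add f g hf hg => simp [hf, hg]
  | single b c =>
    have : (AddMonoidAlgebra.single b c : AddMonoidAlgebra ℂ M) =
      c • AddMonoidAlgebra.single b 1 := by simp
    rw [this, map_smul, map_smul, h]

/-- The linear map prescribed on monomials. -/
noncomputable def ofMonomial {V : Type*} [AddCommGroup V] [Module ℂ V] {M : Type*} (F : M → V) :
    AddMonoidAlgebra ℂ M →ₗ[ℂ] V :=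
  (Finsupp.linearCombination ℂ F) ∘ₗ (AddMonoidAlgebra.coeffLinearEquiv ℂ).toLinearMap

@[simp] theorem ofMonomial_single {V : Type*} [AddCommGroup V] [Module ℂ V] {M : Type*}
    (F : M → V) (b : M) (c : ℂ) : ofMonomial F (AddMonoidAlgebra.single b c) = c • F b := by
  simp [ofMonomial]

/-- The Euler-type operator `t ^ b ↦ p(b) t ^ b` on Laurent polynomials. -/
noncomputable def opLZ (p : MvPolynomial (Fin d) ℂ) : Module.End ℂ (LZ d) :=
  ofMonomial fun b => AddMonoidAlgebra.single b (eval (castC b) p)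

theorem coeff_opLZ (p : MvPolynomial (Fin d) ℂ) (f : LZ d) (x : Fin d → ℤ) :
    (opLZ p f).coeff x = eval (castC x) p * f.coeff x := by
  induction f using AddMonoidAlgebra.induction_linear with
  | zero => simp
  | add f g hf hg => simp [hf, hg, mul_add]
  | single b c =>
    by_cases h : b = x
    · subst h; simp [opLZ, mul_comm]
    · simp [opLZ, h]

theorem opLZ_mem (p : MvPolynomial (Fin d) ℂ) : opLZ p ∈ DiffOp ℂ (LZ d) := by
  induction p using MvPolynomial.induction_on with
  | C c =>
    have : opLZ (C c) = algebraMap ℂ (Module.End ℂ (LZ d)) c := by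
      refine ext_single fun b => ?_
      simp [opLZ]
    rw [this]
    exact (DiffOp ℂ (LZ d)).algebraMap_mem c
  | add p q hp hq =>
    have : opLZ (p + q) = opLZ p + opLZ q := by
      refine ext_single fun b => ?_
      simp [opLZ]
    rw [this]
    exact add_mem hp hq
  | mul_X p j hp =>
    have : opLZ (p * X j) = opLZ p * opLZ (X j) := by
      refine ext_single fun b => ?_
      simp [opLZ, mul_comm]
    rw [this]
    refine mul_mem hp ⟨1, fun f => ?_⟩
    have hder : ∀ f g : LZ d, opLZ (X j) (f * g) = opLZ (X j) f * g + f * opLZ (X j) g := by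
      intro f g
      induction f using AddMonoidAlgebra.induction_linear with
      | zero => simp
      | add f₁ f₂ h₁ h₂ => rw [add_mul, map_add, h₁, h₂, map_add, add_mul, add_mul]; abel
      | single a x =>
        induction g using AddMonoidAlgebra.induction_linear with
        | zero => simp
        | add g₁ g₂ h₁ h₂ => rw [mul_add, map_add, h₁, h₂, map_add, mul_add, mul_add]; abel
        | single b y =>
          simp only [AddMonoidAlgebra.single_mul_single, opLZ, ofMonomial_single, eval_X,
            castC_apply, AddMonoidAlgebra.smul_single, smul_eq_mul]
          rw [← AddMonoidAlgebra.single_add]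
          congr 1
          push_cast [Pi.add_apply]
          ring
    have h : LinearMap.mulLeft ℂ f * opLZ (X j) - opLZ (X j) * LinearMap.mulLeft ℂ f =
        -LinearMap.mulLeft ℂ (opLZ (X j) f) := by
      refine LinearMap.ext fun g => ?_
      simp [hder]
    rw [h]
    intro g
    refine LinearMap.ext fun x => ?_
    simp [mul_left_comm]

theorem mulLeft_mem_diffOp {k S : Type*} [CommRing k] [CommRing S] [Algebra k S] (f : S) :
    LinearMap.mulLeft k f ∈ DiffOp k S := by
  refine ⟨0, fun g => LinearMap.ext fun x => ?_⟩
  simp [mul_left_comm]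

/-- A linear map induced on a subalgebra by a differential operator is a differential operator. -/
theorem mem_diffOpOrder_of_intertwine {k S T : Type*} [CommRing k] [CommRing S] [Algebra k S]
    [CommRing T] [Algebra k T] (i : S →ₐ[k] T) (hi : Function.Injective i) {m : ℕ}
    {P : Module.End k T} (hP : P ∈ diffOpOrder k T m) {Q : Module.End k S}
    (h : ∀ x, i (Q x) = P (i x)) : Q ∈ diffOpOrder k S m := by
  induction m generalizing P Q with
  | zero =>
    intro f
    refine LinearMap.ext fun x => hi ?_
    have := LinearMap.congr_fun (mem_diffOpOrder_zero.1 hP (i f)) (i x)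
    simpa [h] using this
  | succ m ih =>
    intro f
    refine ih (mem_diffOpOrder_succ.1 hP (i f)) fun x => ?_
    simp [h]

/-- The ideal of polynomials vanishing at the points `b ∈ ℕA` with `b + a ∉ ℕA`. -/
def vanish (a : Fin d → ℤ) : Ideal (MvPolynomial (Fin d) ℂ) where
  carrier := {p | ∀ b ∈ NA A, b + a ∉ NA A → eval (castC b) p = 0}
  zero_mem' := by intro b _ _; simp
  add_mem' := by intro p q hp hq b h h'; rw [map_add, hp b h h', hq b h h', add_zero]
  smul_mem' := by intro c p hp b h h'; rw [smul_eq_mul, map_mul, hp b h h', mul_zero]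

variable {A}

open Classical in
/-- The operator `t ^ a p(s) : t ^ b ↦ p(b) t ^ (b + a)` as a linear map on `R_A`. -/
noncomputable def mkMap (a : Fin d → ℤ) (p : MvPolynomial (Fin d) ℂ) : Module.End ℂ (RA A) :=
  ofMonomial fun b => if h : (b : Fin d → ℤ) + a ∈ NA A then
    AddMonoidAlgebra.single ⟨(b : Fin d → ℤ) + a, h⟩ (eval (castC (b : Fin d → ℤ)) p) else 0

theorem toLZ_mkMap (a : Fin d → ℤ) {p : MvPolynomial (Fin d) ℂ} (hp : p ∈ vanish A a) (f : RA A) :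
    toLZ A (mkMap a p f) = AddMonoidAlgebra.single a 1 * opLZ p (toLZ A f) := by
  have : (toLZ A).toLinearMap ∘ₗ mkMap a p =
      LinearMap.mulLeft ℂ (AddMonoidAlgebra.single a 1) ∘ₗ opLZ p ∘ₗ (toLZ A).toLinearMap := by
    refine ext_single fun b => ?_
    by_cases h : (b : Fin d → ℤ) + a ∈ NA A
    · simp [mkMap, opLZ, h, add_comm a]
    · simp [mkMap, opLZ, h, hp b b.2 h]
  exact LinearMap.congr_fun this f

/-- The differential operator `t ^ a p(s)` on `R_A`, for a polynomial `p` vanishing at all `b ∈ ℕA`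
with `b + a ∉ ℕA`. -/
noncomputable def mkOp (a : Fin d → ℤ) (p : MvPolynomial (Fin d) ℂ) (hp : p ∈ vanish A a) :
    DRA A :=
  ⟨mkMap a p, by
    obtain ⟨m, hm⟩ := mul_mem (mulLeft_mem_diffOp (k := ℂ) (AddMonoidAlgebra.single a 1 : LZ d))
      (opLZ_mem p)
    exact ⟨m, mem_diffOpOrder_of_intertwine (toLZ A) (toLZ_injective A) hm (toLZ_mkMap a hp)⟩⟩

variable (A) in
/-- The action of `D(R_A)` on `R_A`. -/
noncomputable def act : DRA A →ₐ[ℂ] Module.End ℂ (RA A) := (DiffOp ℂ (RA A)).val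

theorem act_injective : Function.Injective (act A) := Subtype.val_injective

/-- The coefficient of `t ^ (a + b)` in `P(t ^ b)`. -/
noncomputable def coef (P : Module.End ℂ (RA A)) (a : Fin d → ℤ) (b : NA A) : ℂ :=
  (toLZ A (P (AddMonoidAlgebra.single b 1))).coeff (a + b)

theorem coef_mulLeft_mul (P : Module.End ℂ (RA A)) (a : Fin d → ℤ) (b c : NA A) :
    coef (LinearMap.mulLeft ℂ (AddMonoidAlgebra.single c 1) * P) (a + (c : Fin d → ℤ)) b =
      coef P a b := by
  have : a + (c : Fin d → ℤ) + b = c + (a + b : Fin d → ℤ) := by abel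
  simp [coef, this]

theorem coef_mul_mulLeft (P : Module.End ℂ (RA A)) (a : Fin d → ℤ) (b c : NA A) :
    coef (P * LinearMap.mulLeft ℂ (AddMonoidAlgebra.single c 1)) (a + (c : Fin d → ℤ)) b =
      coef P a (b + c) := by
  have : a + (c : Fin d → ℤ) + b = a + (b + c : Fin d → ℤ) := by abel
  simp [coef, this, add_comm c b]

/-- Differences of the coefficient functions of `P` are coefficient functions of the commutators
of `P` with monomials. -/
theorem fwdDiff_coef (P : Module.End ℂ (RA A)) (a : Fin d → ℤ) (c : NA A) :
    fwdDiff c (coef P a) = coef (-(LinearMap.mulLeft ℂ (AddMonoidAlgebra.single c 1) * P -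
      P * LinearMap.mulLeft ℂ (AddMonoidAlgebra.single c 1))) (a + (c : Fin d → ℤ)) := by
  funext b
  rw [fwdDiff, ← coef_mul_mulLeft, ← coef_mulLeft_mul P a b c]
  simp [coef]

theorem hasDiffOrder_coef {m : ℕ} {P : Module.End ℂ (RA A)} (hP : P ∈ diffOpOrder ℂ (RA A) m)
    (a : Fin d → ℤ) : HasDiffOrder m (coef P a) := by
  induction m generalizing P a with
  | zero =>
    intro c
    rw [fwdDiff_coef, mem_diffOpOrder_zero.1 hP]
    funext b
    simp [coef]
  | succ m ih =>
    intro c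
    rw [fwdDiff_coef]
    exact ih (neg_mem (mem_diffOpOrder_succ.1 hP _)) _

/-- A function on `ℕA` invariant under adding the generators is constant. -/
theorem eq_apply_zero_of_fwdDiff_gen {f : NA A → ℂ} (h : ∀ i, fwdDiff (gen A i) f = 0) (b : NA A) :
    f b = f 0 := by
  have key : ∀ x (hx : x ∈ NA A), ∀ y : NA A, f (y + ⟨x, hx⟩) = f y := by
    intro x hx
    induction hx using AddSubmonoid.closure_induction with
    | mem x hx =>
      obtain ⟨i, rfl⟩ := hx
      intro y
      have := congrFun (h i) y
      rwa [fwdDiff, Pi.zero_apply, sub_eq_zero] at this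
    | zero => intro y; congr 1; exact add_zero y
    | add x y hx hy h₁ h₂ =>
      intro z
      rw [← h₁ z, ← h₂ (z + ⟨x, hx⟩), add_assoc]
      rfl
  simpa using key b b.2 0

theorem finite_coef_zero (P : Module.End ℂ (RA A)) : {a | coef P a 0 ≠ 0}.Finite := by
  refine (toLZ A (P (AddMonoidAlgebra.single 0 1))).coeff.support.finite_toSet.subset ?_
  intro a ha
  simpa [coef] using ha

/-- A differential operator has only finitely many nonzero homogeneous components: in a degree in
which the commutators with the generators of `R_A` have no component, the coefficient function
is constant, hence determined by the value of the operator at `1`. -/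
theorem finite_coef {m : ℕ} {P : Module.End ℂ (RA A)} (hP : P ∈ diffOpOrder ℂ (RA A) m) :
    {a | coef P a ≠ 0}.Finite := by
  have hstep : ∀ (P : Module.End ℂ (RA A)) (a : Fin d → ℤ),
      (∀ i, fwdDiff (gen A i) (coef P a) = 0) → coef P a ≠ 0 → coef P a 0 ≠ 0 := by
    intro P a h hne h00
    exact hne (funext fun b => by rw [eq_apply_zero_of_fwdDiff_gen h b, h00]; rfl)
  induction m generalizing P with
  | zero =>
    exact (finite_coef_zero P).subset fun a ha => hstep P a (fun i => hasDiffOrder_coef hP a _) ha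
  | succ m ih =>
    have hfin := fun i : Fin n => ih (neg_mem (mem_diffOpOrder_succ.1 hP
      (AddMonoidAlgebra.single (gen A i) 1)))
    refine ((finite_coef_zero P).union (Set.finite_iUnion fun i : Fin n =>
      (hfin i).preimage (f := fun a => a + (gen A i : Fin d → ℤ))
        (add_left_injective _).injOn)).subset ?_
    intro a ha
    by_cases h : ∀ i, fwdDiff (gen A i) (coef P a) = 0
    · exact Or.inl (hstep P a h ha)
    · push Not at h
      obtain ⟨i, hi⟩ := h
      rw [fwdDiff_coef] at hi
      exact Or.inr (Set.mem_iUnion.2 ⟨i, hi⟩)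

variable (hA : AddSubgroup.closure (Set.range A) = ⊤)

include hA in
theorem exists_symb (P : DRA A) (a : Fin d → ℤ) :
    ∃ p : MvPolynomial (Fin d) ℂ, ∀ b : NA A, eval (castC (b : Fin d → ℤ)) p =
      coef (act A P) a b := by
  obtain ⟨m, hm⟩ := P.2
  exact (hasDiffOrder_coef hm a).exists_eval_eq hA

/-- The degree `a` symbol of a differential operator `P` on `R_A`: the polynomial whose value at
`b ∈ ℕA` is the coefficient of `t ^ (a + b)` in `P(t ^ b)`. -/
noncomputable def symb (a : Fin d → ℤ) : DRA A →ₗ[ℂ] MvPolynomial (Fin d) ℂ where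
  toFun P := (exists_symb hA P a).choose
  map_add' P Q := by
    refine eq_of_forall_NA hA fun b => ?_
    rw [(exists_symb hA _ a).choose_spec, map_add (eval _), (exists_symb hA P a).choose_spec,
      (exists_symb hA Q a).choose_spec]
    simp [coef]
  map_smul' c P := by
    refine eq_of_forall_NA hA fun b => ?_
    rw [smul_eval, (exists_symb hA _ a).choose_spec, RingHom.id_apply,
      (exists_symb hA P a).choose_spec]
    simp [coef]

theorem eval_symb (P : DRA A) (a : Fin d → ℤ) (b : NA A) :
    eval (castC (b : Fin d → ℤ)) (symb hA a P) = coef (act A P) a b :=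
  (exists_symb hA P a).choose_spec b

theorem finite_symb (P : DRA A) : {a | symb hA a P ≠ 0}.Finite := by
  obtain ⟨m, hm⟩ := P.2
  refine (finite_coef hm).subset fun a ha h => ha ?_
  refine eq_zero_of_forall_NA hA fun b => ?_
  rw [eval_symb]
  exact congrFun h b

theorem ext_symb {P Q : DRA A} (h : ∀ a, symb hA a P = symb hA a Q) : P = Q := by
  refine act_injective (ext_single fun b => toLZ_injective A ?_)
  refine AddMonoidAlgebra.ext (Finsupp.ext fun x => ?_)
  have := congrArg (eval (castC (b : Fin d → ℤ))) (h (x - b))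
  rwa [eval_symb, eval_symb, coef, coef, sub_add_cancel] at this

theorem symb_mem_vanish (P : DRA A) (a : Fin d → ℤ) : symb hA a P ∈ vanish A a := by
  intro b hb h
  rw [eval_symb hA P a ⟨b, hb⟩, coef]
  exact coeff_toLZ_of_notMem A (by rwa [add_comm]) _

theorem toLZ_act_mkOp (a : Fin d → ℤ) {p : MvPolynomial (Fin d) ℂ} (hp : p ∈ vanish A a)
    (f : RA A) :
    toLZ A (act A (mkOp a p hp) f) = AddMonoidAlgebra.single a 1 * opLZ p (toLZ A f) :=
  toLZ_mkMap a hp f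

theorem symb_mkOp_mul (a c : Fin d → ℤ) {p : MvPolynomial (Fin d) ℂ} (hp : p ∈ vanish A a)
    (Q : DRA A) :
    symb hA c (mkOp a p hp * Q) = shift (castC (c - a)) p * symb hA (c - a) Q := by
  refine eq_of_forall_NA hA fun b => ?_
  rw [eval_symb, map_mul (eval _), eval_shift, eval_symb, map_mul, coef, Module.End.mul_apply,
    toLZ_act_mkOp, coef]
  have : c + b = a + (c - a + b : Fin d → ℤ) := by abel
  rw [this, AddMonoidAlgebra.coeff_single_mul_add, coeff_opLZ, one_mul, ← map_add,
    add_comm (b : Fin d → ℤ)]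

theorem symb_mul_mkOp (a c : Fin d → ℤ) {p : MvPolynomial (Fin d) ℂ} (hp : p ∈ vanish A a)
    (Q : DRA A) :
    symb hA c (Q * mkOp a p hp) = shift (castC a) (symb hA (c - a) Q) * p := by
  refine eq_of_forall_NA hA fun b => ?_
  rw [eval_symb, map_mul (eval _), eval_shift, map_mul, coef, Module.End.mul_apply, ← map_add]
  change (toLZ A (act A Q (mkMap a p _))).coeff _ = _
  by_cases h : (b : Fin d → ℤ) + a ∈ NA A
  · have h1 : (AddMonoidAlgebra.single (⟨(b : Fin d → ℤ) + a, h⟩ : NA A)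
        (eval (castC (b : Fin d → ℤ)) p) : RA A) = eval (castC (b : Fin d → ℤ)) p •
          AddMonoidAlgebra.single (⟨(b : Fin d → ℤ) + a, h⟩ : NA A) 1 := by simp
    have h2 : c + b = (c - a + (b + a) : Fin d → ℤ) := by abel
    have h3 := eval_symb hA Q (c - a) ⟨_, h⟩
    rw [mkMap, ofMonomial_single, one_smul, dif_pos h, h1, map_smul, map_smul, h2]
    simp only [coef] at h3
    rw [h3]
    simp [mul_comm]
  · simp [mkMap, h, hp b b.2 h]

theorem one_eq_mkOp (h : (1 : MvPolynomial (Fin d) ℂ) ∈ vanish A 0) :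
    (1 : DRA A) = mkOp 0 1 h := by
  refine act_injective (ext_single fun b => toLZ_injective A ?_)
  rw [toLZ_act_mkOp]
  simp [opLZ]

theorem symb_mkOp (a c : Fin d → ℤ) {p : MvPolynomial (Fin d) ℂ} (hp : p ∈ vanish A a) :
    symb hA c (mkOp a p hp) = if c = a then p else 0 := by
  refine eq_of_forall_NA hA fun b => ?_
  rw [eval_symb, coef, toLZ_act_mkOp]
  have : c + b = a + (c - a + b : Fin d → ℤ) := by abel
  rw [this, AddMonoidAlgebra.coeff_single_mul_add, coeff_opLZ]
  split_ifs with h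
  · subst h; simp
  · simp [sub_eq_zero, h]

variable (A) in
theorem mem_vanish_zero (p : MvPolynomial (Fin d) ℂ) : p ∈ vanish A 0 := by
  intro b hb h
  exact absurd (by simpa using hb) h

variable (A) in
/-- The operator `p(s) : t ^ b ↦ p(b) t ^ b`. -/
noncomputable def op (p : MvPolynomial (Fin d) ℂ) : DRA A := mkOp 0 p (mem_vanish_zero A p)

theorem symb_op (c : Fin d → ℤ) (p : MvPolynomial (Fin d) ℂ) :
    symb hA c (op A p) = if c = 0 then p else 0 := symb_mkOp hA 0 c _

theorem symb_op_mul (c : Fin d → ℤ) (p : MvPolynomial (Fin d) ℂ) (Q : DRA A) :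
    symb hA c (op A p * Q) = shift (castC c) p * symb hA c Q := by
  rw [op, symb_mkOp_mul, sub_zero]

theorem symb_mul_op (c : Fin d → ℤ) (p : MvPolynomial (Fin d) ℂ) (Q : DRA A) :
    symb hA c (Q * op A p) = symb hA c Q * p := by
  rw [op, symb_mul_mkOp, sub_zero]
  congr 1
  exact MvPolynomial.funext fun x => by rw [eval_shift, map_zero, add_zero]

theorem s_eq_op (j : Fin d) : s A j = op A (X j) := by
  refine act_injective (ext_single fun b => toLZ_injective A ?_)
  rw [op, toLZ_act_mkOp]
  change toLZ A (eulerMap A j _) = _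
  simp [eulerMap_single, opLZ]

theorem algebraMap_eq_op (c : ℂ) : algebraMap ℂ (DRA A) c = op A (C c) := by
  refine act_injective (ext_single fun b => toLZ_injective A ?_)
  rw [op, toLZ_act_mkOp, AlgHom.commutes]
  simp [opLZ]

include hA in
theorem op_mul (p q : MvPolynomial (Fin d) ℂ) : op A (p * q) = op A p * op A q := by
  refine ext_symb hA fun a => ?_
  rw [symb_mul_op, symb_op, symb_op]
  split_ifs <;> simp

include hA in
theorem op_add (p q : MvPolynomial (Fin d) ℂ) : op A (p + q) = op A p + op A q := by
  refine ext_symb hA fun a => ?_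
  rw [map_add, symb_op, symb_op, symb_op]
  split_ifs <;> simp

theorem op_one : op A 1 = 1 := (one_eq_mkOp _).symm

/-- The degree `a` homogeneous component of a differential operator on `R_A`. -/
noncomputable def comp (a : Fin d → ℤ) (P : DRA A) : DRA A :=
  mkOp a (symb hA a P) (symb_mem_vanish hA P a)

theorem symb_comp (a c : Fin d → ℤ) (P : DRA A) :
    symb hA c (comp hA a P) = if c = a then symb hA a P else 0 := symb_mkOp hA a c _

theorem sum_comp (P : DRA A) : ∑ a ∈ (finite_symb hA P).toFinset, comp hA a P = P := by
  refine ext_symb hA fun c => ?_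
  rw [map_sum]
  simp only [symb_comp, Finset.sum_ite_eq, Set.Finite.mem_toFinset, Set.mem_ofPred_eq]
  split_ifs with h
  · rfl
  · exact (not_not.1 h).symm

theorem mem_gradedPiece_iff {a : Fin d → ℤ} {P : DRA A} :
    P ∈ gradedPiece A a ↔ ∀ b, b ≠ a → symb hA b P = 0 := by
  have key : ∀ j b, symb hA b (s A j * P - P * s A j) = ((b j : ℤ) : ℂ) • symb hA b P := by
    intro j b
    rw [map_sub, s_eq_op, symb_op_mul, symb_mul_op]
    simp only [shift, aeval_X, castC_apply, smul_eq_C_mul]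
    ring
  constructor
  · intro h b hb
    obtain ⟨j, hj⟩ := Function.ne_iff.1 hb
    have h1 := key j b
    rw [h j, map_smul, ← sub_eq_zero, ← sub_smul, smul_eq_zero] at h1
    refine h1.resolve_left fun h2 => hj ?_
    exact_mod_cast (sub_eq_zero.1 h2).symm
  · intro h j
    refine ext_symb hA fun b => ?_
    rw [key, map_smul]
    by_cases hb : b = a
    · rw [hb]
    · rw [h b hb, smul_zero, smul_zero]

theorem comp_mem_gradedPiece (a : Fin d → ℤ) (P : DRA A) : comp hA a P ∈ gradedPiece A a :=
  (mem_gradedPiece_iff hA).2 fun b hb => by rw [symb_comp, if_neg hb]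

include hA in
theorem op_mem_gradedPiece (p : MvPolynomial (Fin d) ℂ) : op A p ∈ gradedPiece A 0 :=
  (mem_gradedPiece_iff hA).2 fun b hb => by rw [symb_op, if_neg hb]

end Symbols

/-! ### Weight vectors and the modules `M(α)` and `L(α)` -/

section Modules

open MvPolynomial

variable {d n : ℕ} {A : Fin n → Fin d → ℤ} {N : Type*} [AddCommGroup N] [Module (DRA A) N]

/-- The vector `x` of a left `D(R_A)`-module has weight `lam`: each `s_j` acts on it by the scalar
`lam j`. The zero vector has every weight. -/
def IsWeight (lam : Fin d → ℂ) (x : N) : Prop :=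
  ∀ j, s A j • x = algebraMap ℂ (DRA A) (lam j) • x

variable (A) in
theorem isWeight_zero (lam : Fin d → ℂ) : IsWeight (A := A) lam (0 : N) := fun j => by simp

theorem IsWeight.smul {lam : Fin d → ℂ} {x : N} (hx : IsWeight (A := A) lam x) {a : Fin d → ℤ}
    {P : DRA A} (hP : P ∈ gradedPiece A a) : IsWeight (A := A) (lam + castC a) (P • x) := by
  intro j
  have h := hP j
  rw [sub_eq_iff_eq_add] at h
  rw [← mul_smul, h, add_smul, mul_smul, hx j, ← mul_smul, ← Algebra.commutes, Pi.add_apply,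
    map_add, add_smul, mul_smul, add_comm, Algebra.smul_def, mul_smul]
  rfl

variable (hA : AddSubgroup.closure (Set.range A) = ⊤)

include hA in
theorem IsWeight.op_smul {lam : Fin d → ℂ} {x : N} (hx : IsWeight (A := A) lam x)
    (p : MvPolynomial (Fin d) ℂ) : op A p • x = algebraMap ℂ (DRA A) (eval lam p) • x := by
  induction p using MvPolynomial.induction_on with
  | C c => rw [eval_C, algebraMap_eq_op]
  | add p q hp hq => rw [op_add hA, add_smul, hp, hq, map_add, map_add, add_smul]
  | mul_X p j hp =>
    rw [op_mul hA, ← s_eq_op, mul_smul, hx j, ← mul_smul, ← Algebra.commutes, mul_smul, hp,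
      ← mul_smul, ← map_mul, map_mul (eval lam), eval_X, mul_comm]

include hA in
/-- Weight vectors of distinct weights `α + b` are independent: a suitable polynomial in the Euler
operators isolates any one of them. -/
theorem IsWeight.eq_zero_of_sum_eq_zero (α : Fin d → ℂ) (F : Finset (Fin d → ℤ))
    {y : (Fin d → ℤ) → N} (hy : ∀ b ∈ F, IsWeight (A := A) (α + castC b) (y b))
    (h : ∑ b ∈ F, y b = 0) {a : Fin d → ℤ} (ha : a ∈ F) : y a = 0 := by
  classical
  obtain ⟨p, hp, hF⟩ := exists_eval_eq_one_of_notMem (x := α + castC a)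
    ((F.erase a).image fun b => α + castC b) (by
      simp only [Finset.mem_image, Finset.mem_erase, not_exists, not_and]
      rintro b ⟨hb, _⟩ hab
      exact hb (castC_injective (add_left_cancel hab)))
  have h1 : op A p • ∑ b ∈ F, y b = y a := by
    rw [Finset.smul_sum, Finset.sum_eq_single a]
    · rw [(hy a ha).op_smul hA, hp, map_one, one_smul]
    · intro b hb hba
      rw [(hy b hb).op_smul hA, hF _ (Finset.mem_image_of_mem _ (Finset.mem_erase.2 ⟨hba, hb⟩)),
        map_zero, zero_smul]
    · exact fun h => absurd ha h
  rw [← h1, h, smul_zero]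

theorem isWeight_mk_one (α : Fin d → ℂ) {I : Submodule (DRA A) (DRA A)} (hI : relations A α ≤ I) :
    IsWeight (A := A) α (Submodule.Quotient.mk 1 : DRA A ⧸ I) := by
  intro j
  rw [← Submodule.Quotient.mk_smul, ← Submodule.Quotient.mk_smul, Submodule.Quotient.eq,
    smul_eq_mul, smul_eq_mul, mul_one, mul_one]
  exact hI (Submodule.subset_span ⟨j, rfl⟩)

theorem mk_eq_smul_mk_one {I : Submodule (DRA A) (DRA A)} (P : DRA A) :
    (Submodule.Quotient.mk P : DRA A ⧸ I) = P • Submodule.Quotient.mk 1 := by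
  rw [← Submodule.Quotient.mk_smul, smul_eq_mul, mul_one]

theorem comp_eq_zero {a : Fin d → ℤ} {P : DRA A} (h : symb hA a P = 0) : comp hA a P = 0 := by
  refine ext_symb hA fun b => ?_
  rw [symb_comp, h, map_zero, ite_self]

/-- A left ideal containing the relations of `M(α)` is homogeneous. -/
theorem comp_mem {α : Fin d → ℂ} {I : Submodule (DRA A) (DRA A)} (hI : relations A α ≤ I)
    {P : DRA A} (hP : P ∈ I) (a : Fin d → ℤ) : comp hA a P ∈ I := by
  by_cases ha : symb hA a P = 0
  · rw [comp_eq_zero hA ha]; exact zero_mem _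
  rw [← Submodule.Quotient.mk_eq_zero I, mk_eq_smul_mk_one]
  refine IsWeight.eq_zero_of_sum_eq_zero hA α (finite_symb hA P).toFinset
    (y := fun b => comp hA b P • (Submodule.Quotient.mk 1 : DRA A ⧸ I))
    (fun b _ => (isWeight_mk_one α hI).smul (comp_mem_gradedPiece hA b P)) ?_ (by simpa using ha)
  rw [← Finset.sum_smul, sum_comp, ← mk_eq_smul_mk_one]
  exact (Submodule.Quotient.mk_eq_zero I).2 hP

/-- The largest proper left ideal `{P | σ_0(Q P)(α) = 0 for all Q}` of `D(R_A)` containing the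
relations of `M(α)`, where `σ_0` is the symbol of degree `0`. -/
noncomputable def maxIdeal (α : Fin d → ℂ) : Submodule (DRA A) (DRA A) where
  carrier := {P | ∀ Q, eval α (symb hA 0 (Q * P)) = 0}
  zero_mem' := by intro Q; simp
  add_mem' := by intro P P' hP hP' Q; rw [mul_add, map_add, map_add, hP, hP', add_zero]
  smul_mem' := by intro R P hP Q; rw [smul_eq_mul, ← mul_assoc]; exact hP _

theorem relations_le_maxIdeal (α : Fin d → ℂ) : relations A α ≤ maxIdeal hA α := by
  refine Submodule.span_le.2 ?_
  rintro _ ⟨j, rfl⟩ Q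
  beta_reduce
  rw [s_eq_op, algebraMap_eq_op, mul_sub, map_sub, symb_mul_op, symb_mul_op]
  simp

theorem one_notMem_maxIdeal (α : Fin d → ℂ) : (1 : DRA A) ∉ maxIdeal hA α := by
  intro h
  have := h 1
  rw [mul_one, ← op_one, symb_op, if_pos rfl, map_one] at this
  exact one_ne_zero this

/-- A left ideal containing the relations and some `P` with `σ_0(Q P)(α) ≠ 0` is the unit ideal: it
contains the degree `0` component of `Q P`, which is a nonzero constant modulo the relations. -/
theorem le_maxIdeal {α : Fin d → ℂ} {I : Submodule (DRA A) (DRA A)} (hI : relations A α ≤ I)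
    (hne : I ≠ ⊤) : I ≤ maxIdeal hA α := by
  intro P hP Q
  by_contra h0
  have h1 : op A (symb hA 0 (Q * P)) ∈ I := comp_mem hA hI (I.smul_mem Q hP) 0
  rw [← Submodule.Quotient.mk_eq_zero I, mk_eq_smul_mk_one, (isWeight_mk_one α hI).op_smul hA,
    ← mk_eq_smul_mk_one, Submodule.Quotient.mk_eq_zero] at h1
  refine hne (Ideal.eq_top_of_isUnit_mem I h1 ?_)
  exact (IsUnit.mk0 _ h0).map (algebraMap ℂ (DRA A))

theorem maxSubmodule_eq (α : Fin d → ℂ) :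
    maxSubmodule A α = (maxIdeal hA α).map (relations A α).mkQ := by
  have hcomap : ((maxIdeal hA α).map (relations A α).mkQ).comap (relations A α).mkQ =
      maxIdeal hA α := by
    rw [Submodule.comap_map_mkQ, sup_eq_right]
    exact relations_le_maxIdeal hA α
  refine le_antisymm (sSup_le fun W hW => ?_) (le_sSup ?_)
  · have h1 : W.comap (relations A α).mkQ ≤ maxIdeal hA α := by
      refine le_maxIdeal hA ?_ fun h => hW ?_
      · exact Submodule.le_comap_mkQ _ _
      · have := congrArg (Submodule.map (relations A α).mkQ) h
        rwa [Submodule.map_comap_eq_of_surjective (Submodule.mkQ_surjective _), Submodule.map_top,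
          Submodule.range_mkQ] at this
    have := Submodule.map_mono (f := (relations A α).mkQ) h1
    rwa [Submodule.map_comap_eq_of_surjective (Submodule.mkQ_surjective _)] at this
  · intro h
    rw [h, Submodule.comap_top] at hcomap
    exact one_notMem_maxIdeal hA α (hcomap ▸ Submodule.mem_top)

theorem mk_mem_maxSubmodule {α : Fin d → ℂ} {P : DRA A} :
    (Submodule.Quotient.mk P : M A α) ∈ maxSubmodule A α ↔ P ∈ maxIdeal hA α := by
  have hcomap : ((maxIdeal hA α).map (relations A α).mkQ).comap (relations A α).mkQ =
      maxIdeal hA α := by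
    rw [Submodule.comap_map_mkQ, sup_eq_right]
    exact relations_le_maxIdeal hA α
  rw [maxSubmodule_eq hA]
  conv_rhs => rw [← hcomap]
  rfl

theorem mem_annihilator_L {α : Fin d → ℂ} {P : DRA A} :
    P ∈ Module.annihilator (DRA A) (L A α) ↔ ∀ Q, P * Q ∈ maxIdeal hA α := by
  rw [Module.mem_annihilator]
  constructor
  · intro h Q
    have := h (Submodule.Quotient.mk (Submodule.Quotient.mk Q))
    rwa [← Submodule.Quotient.mk_smul, ← Submodule.Quotient.mk_smul,
      Submodule.Quotient.mk_eq_zero, mk_mem_maxSubmodule hA] at this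
  · intro h x
    obtain ⟨x, rfl⟩ := Submodule.Quotient.mk_surjective _ x
    obtain ⟨Q, rfl⟩ := Submodule.Quotient.mk_surjective _ x
    rw [← Submodule.Quotient.mk_smul, ← Submodule.Quotient.mk_smul,
      Submodule.Quotient.mk_eq_zero, mk_mem_maxSubmodule hA]
    exact h Q

/-! ### The grading of `L(α)` -/

variable (A) in
/-- The component of degree `a` of `L(α)`: the vectors of weight `α + a`. -/
noncomputable def gradedL (α : Fin d → ℂ) (a : Fin d → ℤ) : AddSubgroup (L A α) where
  carrier := {x | IsWeight (A := A) (α + castC a) x}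
  zero_mem' := isWeight_zero A _
  add_mem' := by intro x y hx hy j; rw [smul_add, smul_add, hx j, hy j]
  neg_mem' := by intro x hx j; rw [smul_neg, smul_neg, hx j]

include hA in
theorem isGradedSimple_L (α : Fin d → ℂ) : IsGradedSimple A (L A α) (gradedL A α) where
  isInternal := by
    classical
    constructor
    · rw [injective_iff_map_eq_zero]
      intro x hx
      rw [DirectSum.coeAddMonoidHom_eq_dfinsuppSum, DFinsupp.sum] at hx
      refine DFinsupp.ext fun a => ?_
      by_cases ha : a ∈ DFinsupp.support x
      · exact Subtype.ext (IsWeight.eq_zero_of_sum_eq_zero hA α (DFinsupp.support x)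
          (y := fun a => (x a : L A α)) (fun b _ => (x b).2) hx ha)
      · simpa using ha
    · intro x
      obtain ⟨x, rfl⟩ := Submodule.Quotient.mk_surjective _ x
      obtain ⟨P, rfl⟩ := Submodule.Quotient.mk_surjective _ x
      rw [mk_eq_smul_mk_one, Submodule.Quotient.mk_smul, ← sum_comp hA P, Finset.sum_smul]
      change _ ∈ AddMonoidHom.mrange _
      refine sum_mem fun a _ => ⟨DirectSum.of (fun a => gradedL A α a) a ⟨_, ?_⟩,
        DirectSum.coeAddMonoidHom_of _ _ _⟩
      refine IsWeight.smul ?_ (comp_mem_gradedPiece hA a P)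
      intro j
      rw [← Submodule.Quotient.mk_smul, isWeight_mk_one α le_rfl j, Submodule.Quotient.mk_smul]
  smul_mem a b P x hP hx := by
    have := IsWeight.smul hx hP
    rwa [add_assoc, ← map_add, add_comm b] at this
  nontrivial := by
    refine Submodule.Quotient.nontrivial_iff.2 fun h => one_notMem_maxIdeal hA α ?_
    rw [← mk_mem_maxSubmodule hA, h]
    trivial
  eq_bot_or_eq_top W _ := by
    by_cases h : W.comap (maxSubmodule A α).mkQ = ⊤
    · right
      have := congrArg (Submodule.map (maxSubmodule A α).mkQ) h
      rwa [Submodule.map_comap_eq_of_surjective (Submodule.mkQ_surjective _), Submodule.map_top,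
          Submodule.range_mkQ] at this
    · left
      have h1 : W.comap (maxSubmodule A α).mkQ ≤ maxSubmodule A α := le_sSup h
      have := Submodule.map_mono (f := (maxSubmodule A α).mkQ) h1
      rwa [Submodule.map_comap_eq_of_surjective (Submodule.mkQ_surjective _),
        Submodule.mkQ_map_self, le_bot_iff] at this

end Modules

/-! ### Graded simple modules -/

section GradedSimple

open MvPolynomial

variable {d n : ℕ} {A : Fin n → Fin d → ℤ} {N : Type} [AddCommGroup N] [Module (DRA A) N]
  {𝓜 : (Fin d → ℤ) → AddSubgroup N} (hA : AddSubgroup.closure (Set.range A) = ⊤)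

/-- In an internally graded group a homogeneous sum equals its component of the same degree. -/
theorem eq_of_sum_eq_of_isInternal (h : DirectSum.IsInternal 𝓜) (F : Finset (Fin d → ℤ))
    {z : (Fin d → ℤ) → N} (hz : ∀ b, z b ∈ 𝓜 b) (hF : ∀ b ∉ F, z b = 0) {b : Fin d → ℤ} {x : N}
    (hx : x ∈ 𝓜 b) (hsum : ∑ a ∈ F, z a = x) : x = z b := by
  classical
  have h1 : ∑ a ∈ F, DirectSum.of (fun a => 𝓜 a) a ⟨z a, hz a⟩ =
      DirectSum.of (fun a => 𝓜 a) b ⟨x, hx⟩ := by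
    apply h.1
    rw [map_sum, DirectSum.coeAddMonoidHom_of]
    simp only [DirectSum.coeAddMonoidHom_of, hsum]
  have h2 := congrArg (fun y => ((y b : 𝓜 b) : N)) h1
  rw [DirectSum.of_eq_same] at h2
  refine h2.symm.trans ?_
  rw [DFinsupp.finsetSum_apply, AddSubgroup.val_finsetSum, Finset.sum_eq_single b]
  · rw [DirectSum.of_eq_same]
  · intro a _ hab
    rw [DirectSum.of_eq_of_ne _ _ _ hab.symm, AddSubgroup.coe_zero]
  · intro hb
    rw [DirectSum.of_eq_same]
    exact hF b hb

/-- The submodule generated by the multiples of a homogeneous vector by a homogeneous left ideal is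
graded. -/
theorem map_toSpanSingleton_graded (h : IsGradedSimple A N 𝓜) {b : Fin d → ℤ} {x : N}
    (hx : x ∈ 𝓜 b) {I : Submodule (DRA A) (DRA A)} (hI : ∀ P ∈ I, ∀ a, comp hA a P ∈ I) :
    (I.map (LinearMap.toSpanSingleton (DRA A) N x)).toAddSubgroup =
      ⨆ a, (I.map (LinearMap.toSpanSingleton (DRA A) N x)).toAddSubgroup ⊓ 𝓜 a := by
  refine le_antisymm ?_ (iSup_le fun a => inf_le_left)
  rintro _ ⟨P, hP, rfl⟩
  rw [LinearMap.toSpanSingleton_apply, ← sum_comp hA P, Finset.sum_smul]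
  refine sum_mem fun a _ => AddSubgroup.mem_iSup_of_mem (a + b) ⟨⟨comp hA a P, hI P hP a, rfl⟩, ?_⟩
  exact h.smul_mem a b _ x (comp_mem_gradedPiece hA a P) hx

include hA in
/-- A nonzero homogeneous vector of a graded simple module generates it. -/
theorem exists_smul_eq (h : IsGradedSimple A N 𝓜) {b : Fin d → ℤ} {x : N}
    (hx : x ∈ 𝓜 b) (h0 : x ≠ 0) (y : N) : ∃ P : DRA A, P • x = y := by
  have hg := map_toSpanSingleton_graded hA h hx (I := ⊤) fun _ _ _ => Submodule.mem_top
  rcases h.eq_bot_or_eq_top _ hg with h1 | h1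
  · refine absurd ?_ h0
    have : x ∈ Submodule.map (LinearMap.toSpanSingleton (DRA A) N x) ⊤ :=
      ⟨1, Submodule.mem_top, by simp⟩
    rwa [h1, Submodule.mem_bot] at this
  · have : y ∈ Submodule.map (LinearMap.toSpanSingleton (DRA A) N x) ⊤ := h1 ▸ Submodule.mem_top
    obtain ⟨P, _, hP⟩ := this
    exact ⟨P, hP⟩

include hA in
/-- A nonzero homogeneous vector of a graded simple module is a weight vector: the degree `0`
component of `D(R_A)` is the polynomial ring in the Euler operators and acts irreducibly on each
component, so that the Nullstellensatz applies. -/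
theorem exists_isWeight (h : IsGradedSimple A N 𝓜) {b : Fin d → ℤ} {x : N}
    (hx : x ∈ 𝓜 b) (h0 : x ≠ 0) : ∃ α : Fin d → ℂ, IsWeight (A := A) α x := by
  let J : Ideal (MvPolynomial (Fin d) ℂ) :=
    { carrier := {p | op A p • x = 0}
      zero_mem' := by
        change op A 0 • x = 0
        rw [← C_0, ← algebraMap_eq_op, map_zero, zero_smul]
      add_mem' := by
        intro p q hp hq
        change op A (p + q) • x = 0
        rw [op_add hA, add_smul, hp, hq, add_zero]
      smul_mem' := by
        intro q p hp
        change op A (q * p) • x = 0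
        rw [op_mul hA, mul_smul, hp, smul_zero] }
  have hJ : ∀ p, p ∈ J ↔ op A p • x = 0 := fun p => Iff.rfl
  -- for `p ∉ J` the nonzero vector `p(s) x` generates `x`, which inverts `p` modulo `J`
  have hmax : J.IsMaximal := by
    rw [Ideal.isMaximal_iff]
    refine ⟨fun h1 => h0 ?_, fun J' p hJJ' hp hpJ' => ?_⟩
    · rwa [hJ, op_one, one_smul] at h1
    · have hy : op A p • x ∈ 𝓜 b := by
        have := h.smul_mem 0 b _ x (op_mem_gradedPiece hA p) hx
        rwa [zero_add] at this
      obtain ⟨P, hP⟩ := exists_smul_eq hA h hy hp x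
      have hP0 : x = op A (symb hA 0 P) • op A p • x := by
        refine (eq_of_sum_eq_of_isInternal h.isInternal
          ((finite_symb hA P).toFinset.image fun a => a + b)
          (z := fun a => comp hA (a - b) P • op A p • x) (fun a => ?_) (fun a ha => ?_) hx
          ?_).trans ?_
        · have := h.smul_mem (a - b) b _ _ (comp_mem_gradedPiece hA (a - b) P) hy
          rwa [sub_add_cancel] at this
        · have : symb hA (a - b) P = 0 := by
            by_contra hne
            exact ha (Finset.mem_image.2 ⟨a - b, by simpa using hne, sub_add_cancel a b⟩)
          rw [comp_eq_zero hA this, zero_smul]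
        · rw [Finset.sum_image (by simp)]
          simp only [add_sub_cancel_right]
          rw [← Finset.sum_smul, sum_comp, hP]
        · simp only [sub_self]; rfl
      have h1 : 1 - symb hA 0 P * p ∈ J := by
        have h2 := op_add hA (1 - symb hA 0 P * p) (symb hA 0 P * p)
        rw [sub_add_cancel, op_one, op_mul hA] at h2
        have h3 := congrArg (· • x) h2
        simp only [one_smul, add_smul, mul_smul, ← hP0] at h3
        rw [hJ]
        exact right_eq_add.1 h3
      have := J'.add_mem (hJJ' h1) (J'.mul_mem_left (symb hA 0 P) hpJ')
      rwa [sub_add_cancel] at this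
  obtain ⟨α, hα⟩ := (MvPolynomial.isMaximal_iff_eq_vanishingIdeal_singleton (I := J)).1 hmax
  refine ⟨α, fun j => ?_⟩
  have : X j - C (α j) ∈ J := by
    rw [hα, mem_vanishingIdeal_singleton_iff]
    simp
  have h2 := op_add hA (X j - C (α j)) (C (α j))
  rw [sub_add_cancel, ← s_eq_op, ← algebraMap_eq_op] at h2
  rw [h2, add_smul, (hJ _).1 this, zero_add]

include hA in
/-- The annihilator of a graded simple module is the annihilator of some `L(α)`. -/
theorem exists_annihilator_eq (h : IsGradedSimple A N 𝓜) :
    ∃ α : Fin d → ℂ, Module.annihilator (DRA A) N = Module.annihilator (DRA A) (L A α) := by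
  have hnt := h.nontrivial
  obtain ⟨b, x, hx, h0⟩ : ∃ b, ∃ x ∈ 𝓜 b, x ≠ 0 := by
    by_contra! hall
    obtain ⟨y, hy⟩ := exists_ne (0 : N)
    obtain ⟨f, rfl⟩ := h.isInternal.2 y
    refine hy ?_
    clear hy
    induction f using DirectSum.induction_on with
    | zero => exact map_zero _
    | of a z => rw [DirectSum.coeAddMonoidHom_of]; exact hall a z z.2
    | add f g hf hg => rw [map_add, hf, hg, add_zero]
  obtain ⟨α, hα⟩ := exists_isWeight hA h hx h0
  set J := LinearMap.ker (LinearMap.toSpanSingleton (DRA A) N x) with hJ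
  have hrel : relations A α ≤ J := by
    refine Submodule.span_le.2 ?_
    rintro _ ⟨j, rfl⟩
    simp [hJ, sub_smul, hα j]
  have hle : J ≤ maxIdeal hA α := le_maxIdeal hA hrel fun h1 => h0 (by
    have : (1 : DRA A) ∈ J := h1 ▸ Submodule.mem_top
    simpa [hJ] using this)
  have hJK : J = maxIdeal hA α := by
    refine le_antisymm hle ?_
    have hg := map_toSpanSingleton_graded hA h hx (I := maxIdeal hA α)
      fun P hP a => comp_mem hA (relations_le_maxIdeal hA α) hP a
    rcases h.eq_bot_or_eq_top _ hg with h1 | h1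
    · intro P hP
      have : P • x ∈ (maxIdeal hA α).map (LinearMap.toSpanSingleton (DRA A) N x) :=
        ⟨P, hP, rfl⟩
      rwa [h1, Submodule.mem_bot] at this
    -- otherwise `x = P x` with `P ∈ maxIdeal hA α`, and then `1 = (1 - P) + P` is in it too
    · exfalso
      have : x ∈ (maxIdeal hA α).map (LinearMap.toSpanSingleton (DRA A) N x) :=
        h1 ▸ Submodule.mem_top
      obtain ⟨P, hP, hPx⟩ := this
      rw [LinearMap.toSpanSingleton_apply] at hPx
      have h2 : 1 - P ∈ J := by
        rw [hJ, LinearMap.mem_ker, LinearMap.toSpanSingleton_apply, sub_smul, hPx, one_smul,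
          sub_self]
      refine one_notMem_maxIdeal hA α ?_
      have := add_mem (hle h2) hP
      rwa [sub_add_cancel] at this
  refine ⟨α, Ideal.ext fun P => ?_⟩
  rw [mem_annihilator_L hA, ← hJK, Module.mem_annihilator]
  constructor
  · intro hP Q
    rw [hJ, LinearMap.mem_ker, LinearMap.toSpanSingleton_apply, mul_smul, hP]
  · intro hP y
    obtain ⟨Q, rfl⟩ := exists_smul_eq hA h hx h0 y
    have := hP Q
    rwa [hJ, LinearMap.mem_ker, LinearMap.toSpanSingleton_apply, mul_smul] at this

end GradedSimple

/-! ### Nonvanishing of symbols at a weight -/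

section Criterion

open MvPolynomial

/-- Membership in an upper set of `ℕ^n` is unchanged by truncating all coordinates at a suitable
bound, by Dickson's lemma. -/
theorem exists_truncation {n : ℕ} {J : Set (Fin n → ℕ)} (hJ : IsUpperSet J) :
    ∃ B : ℕ, ∀ u, u ∈ J → (u ⊓ fun _ => B) ∈ J := by
  have hfin : {u | Minimal (· ∈ J) u}.Finite := by
    refine WellQuasiOrderedLE.finite_of_isAntichain fun u hu v hv huv hle => huv ?_
    exact le_antisymm hle (hv.2 hu.1 hle)
  obtain ⟨B, hB⟩ := (hfin.image fun u => Finset.univ.sup u).bddAbove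
  refine ⟨B, fun u hu => ?_⟩
  obtain ⟨m, hmu, hm⟩ := exists_minimal_le_of_wellFoundedLT (· ∈ J) u hu
  refine hJ (le_inf hmu fun i => ?_) hm.1
  exact (Finset.le_sup (Finset.mem_univ i)).trans (hB ⟨m, hm, rfl⟩)

variable {d n : ℕ}

theorem exists_eval_ne_zero_of_notMem_submodule {W : Submodule ℂ (Fin d → ℂ)}
    {x α : Fin d → ℂ} (h : α - x ∉ W) :
    ∃ p : MvPolynomial (Fin d) ℂ, eval α p ≠ 0 ∧ ∀ v ∈ W, eval (x + v) p = 0 := by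
  obtain ⟨f, hf, hW⟩ := Submodule.exists_le_ker_of_notMem h
  have key : ∀ y, eval y (∑ j, C (f (Pi.single j 1)) * (X j - C (x j)) :
      MvPolynomial (Fin d) ℂ) = f (y - x) := by
    intro y
    conv_rhs => rw [← Finset.univ_sum_single (y - x), map_sum]
    rw [map_sum]
    refine Finset.sum_congr rfl fun j _ => ?_
    have : (Pi.single j ((y - x) j) : Fin d → ℂ) = (y - x) j • Pi.single j 1 := by
      rw [← Pi.single_smul, smul_eq_mul, mul_one]
    rw [this, map_smul]
    simp [mul_comm]
  refine ⟨_, (key α).trans_ne hf, fun v hv => ?_⟩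
  rw [key, add_sub_cancel_left]
  exact hW hv

variable (A : Fin n → Fin d → ℤ)

/-- The monoid `ℕτ` generated by the columns with index in `τ`. -/
def natSpan (τ : Set (Fin n)) : AddSubmonoid (Fin d → ℤ) := AddSubmonoid.closure (A '' τ)

/-- The group `ℤτ` generated by the columns with index in `τ`. -/
def intSpan (τ : Set (Fin n)) : AddSubgroup (Fin d → ℤ) := AddSubgroup.closure (A '' τ)

/-- The complex vector space `ℂτ` spanned by the columns with index in `τ`. -/
def complexSpan (τ : Set (Fin n)) : Submodule ℂ (Fin d → ℂ) :=
  Submodule.span ℂ ((fun i => castC (A i)) '' τ)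

/-- The set `E_τ(α) = {λ ∈ ℂτ | α - λ ∈ ℕA + ℤτ}`, the last condition being expressed by
`α - λ + w ∈ ℕA` for some `w ∈ ℕτ`. -/
def E (α : Fin d → ℂ) (τ : Set (Fin n)) : Set (Fin d → ℂ) :=
  {l | l ∈ complexSpan A τ ∧
    ∃ y : Fin d → ℤ, castC y = α - l ∧ ∃ w ∈ natSpan A τ, y + w ∈ NA A}

variable {A}

theorem natSpan_le_NA (τ : Set (Fin n)) : natSpan A τ ≤ NA A :=
  AddSubmonoid.closure_mono (Set.image_subset_range _ _)

theorem castC_mem_complexSpan_of_intSpan {τ : Set (Fin n)} {z : Fin d → ℤ}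
    (hz : z ∈ intSpan A τ) : castC z ∈ complexSpan A τ := by
  induction hz using AddSubgroup.closure_induction with
  | mem x hx =>
    obtain ⟨i, hi, rfl⟩ := hx
    exact Submodule.subset_span ⟨i, hi, rfl⟩
  | zero => rw [map_zero]; exact zero_mem _
  | add x y _ _ hx hy => rw [map_add]; exact add_mem hx hy
  | neg x _ hx => rw [map_neg]; exact neg_mem hx

theorem natSpan_le_intSpan {τ : Set (Fin n)} {w : Fin d → ℤ} (hw : w ∈ natSpan A τ) :
    w ∈ intSpan A τ :=
  AddSubgroup.le_closure_toAddSubmonoid _ hw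

theorem complexSpan_le_span_natSpan (τ : Set (Fin n)) :
    complexSpan A τ ≤ Submodule.span ℂ
      (((natSpan A τ).map (castC (d := d)) : AddSubmonoid (Fin d → ℂ)) : Set (Fin d → ℂ)) := by
  refine Submodule.span_mono ?_
  rintro _ ⟨i, hi, rfl⟩
  exact AddSubmonoid.mem_map_of_mem _ (AddSubmonoid.subset_closure ⟨i, hi, rfl⟩)

theorem exists_nat_of_mem_natSpan {τ : Set (Fin n)} {w : Fin d → ℤ} (hw : w ∈ natSpan A τ) :
    ∃ v : Fin n → ℕ, (∀ i ∉ τ, v i = 0) ∧ w = ∑ i, v i • A i := by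
  classical
  induction hw using AddSubmonoid.closure_induction with
  | mem x hx =>
    obtain ⟨i, hi, rfl⟩ := hx
    refine ⟨Pi.single i 1, fun j hj => ?_, ?_⟩
    · exact Pi.single_eq_of_ne (by rintro rfl; exact hj hi) _
    · rw [Finset.sum_eq_single i]
      · simp
      · intro j _ hj
        rw [Pi.single_eq_of_ne hj, zero_smul]
      · simp
  | zero => exact ⟨0, fun _ _ => rfl, by simp⟩
  | add x y _ _ hx hy =>
    obtain ⟨u, hu, rfl⟩ := hx
    obtain ⟨v, hv, rfl⟩ := hy
    refine ⟨u + v, fun i hi => by simp [hu i hi, hv i hi], ?_⟩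
    rw [← Finset.sum_add_distrib]
    exact Finset.sum_congr rfl fun i _ => (add_smul _ _ _).symm

theorem sum_smul_mem_natSpan {τ : Set (Fin n)} {v : Fin n → ℕ} (hv : ∀ i ∉ τ, v i = 0) :
    ∑ i, v i • A i ∈ natSpan A τ := by
  refine sum_mem fun i _ => ?_
  by_cases hi : i ∈ τ
  · exact nsmul_mem (AddSubmonoid.subset_closure (Set.mem_image_of_mem _ hi)) _
  · rw [hv i hi, zero_smul]; exact zero_mem _

/-- If `E_τ(α) ⊄ E_τ(α + b)`, then some translate of `ℕτ` lies in `{x ∈ ℕA | x + b ∉ ℕA}` and has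
`α` in its Zariski closure. -/
theorem E_subset_of_exists {α : Fin d → ℂ} {b : Fin d → ℤ} {p : MvPolynomial (Fin d) ℂ}
    (hp : p ∈ vanish A b) (h : eval α p ≠ 0) (τ : Set (Fin n)) :
    E A α τ ⊆ E A (α + castC b) τ := by
  rintro l ⟨hl, y, hy, w, hw, hyw⟩
  refine ⟨hl, y + b, by rw [map_add, hy]; abel, ?_⟩
  by_contra! hno
  refine h ?_
  have hα : α = castC (y + w) + (l - castC w) := by rw [map_add, hy]; abel
  rw [hα]
  refine eval_add_eq_zero_of_mem_span ((natSpan A τ).map (castC (d := d))) ?_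
    (complexSpan_le_span_natSpan τ
      (sub_mem hl (castC_mem_complexSpan_of_intSpan (natSpan_le_intSpan hw))))
  rintro _ ⟨v, hv, rfl⟩
  rw [← map_add]
  refine hp _ (add_mem hyw (natSpan_le_NA τ hv)) ?_
  have := hno (w + v) (add_mem hw hv)
  have h2 : y + w + v + b = y + b + (w + v) := by abel
  rwa [h2]

/-- If `E_τ(α) ⊆ E_τ(α + b)` for all `τ`, then some `t ^ b p(s)` in `D(R_A)` has `p(α) ≠ 0`. The set
`{x ∈ ℕA | x + b ∉ ℕA}` is a finite union of sets `x + ℕτ`, and none of the spaces `x + ℂτ`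
contains `α`. -/
theorem exists_of_E_subset {α : Fin d → ℂ} {b : Fin d → ℤ}
    (h : ∀ τ, E A α τ ⊆ E A (α + castC b) τ) : ∃ p ∈ vanish A b, eval α p ≠ 0 := by
  classical
  set J : Set (Fin n → ℕ) := {u | ∑ i, u i • A i + b ∈ NA A} with hJdef
  have hJ : IsUpperSet J := by
    intro u v huv hu
    have : ∑ i, v i • A i + b = (∑ i, u i • A i + b) + ∑ i, (v i - u i) • A i := by
      rw [add_right_comm, ← Finset.sum_add_distrib]
      congr 1
      refine Finset.sum_congr rfl fun i _ => ?_
      rw [← add_smul, Nat.add_sub_cancel' (huv i)]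
    rw [hJdef, Set.mem_ofPred_eq, this]
    exact add_mem hu (sum_smul_mem_NA A _)
  obtain ⟨B, hB⟩ := exists_truncation hJ
  have hex : ∀ u : Fin n → ℕ, u ≤ (fun _ => B) → u ∉ J → ∃ p : MvPolynomial (Fin d) ℂ,
      eval α p ≠ 0 ∧ ∀ v ∈ complexSpan A {i | u i = B},
        eval (castC (∑ i, u i • A i) + v) p = 0 := by
    intro u hu huJ
    refine exists_eval_ne_zero_of_notMem_submodule fun hmem => huJ ?_
    obtain ⟨_, y, hy, w, hw, hyw⟩ := h {i | u i = B} ⟨hmem, ∑ i, u i • A i, by abel, 0,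
      zero_mem _, by rw [add_zero]; exact sum_smul_mem_NA A u⟩
    have hy' : y = ∑ i, u i • A i + b := by
      apply castC_injective
      rw [hy, map_add]; abel
    obtain ⟨v, hv, rfl⟩ := exists_nat_of_mem_natSpan hw
    have h1 : u + v ∈ J := by
      have : ∑ i, (u + v) i • A i + b = y + ∑ i, v i • A i := by
        rw [hy', add_right_comm, ← Finset.sum_add_distrib]
        congr 1
        exact Finset.sum_congr rfl fun i _ => add_smul _ _ _
      rw [hJdef, Set.mem_ofPred_eq, this]
      exact hyw
    -- `v` is supported where `u` has reached the bound, so truncating `u + v` gives back `u`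
    convert hB _ h1 using 1
    funext i
    by_cases hi : u i = B
    · simp [hi]
    · simp [hv i hi, hu i]
  choose! p hp0 hp using hex
  refine ⟨∏ u ∈ (Finset.Icc 0 (fun _ => B)).filter (· ∉ J), p u, fun x hx hxb => ?_, ?_⟩
  · obtain ⟨u, rfl⟩ := exists_nat_of_mem_NA A hx
    set u' : Fin n → ℕ := u ⊓ fun _ => B with hu'
    have hu'J : u' ∉ J := fun h1 => hxb (hJ inf_le_left h1)
    rw [map_prod]
    refine Finset.prod_eq_zero (i := u') ?_ ?_
    · exact Finset.mem_filter.2 ⟨Finset.mem_Icc.2 ⟨fun i => Nat.zero_le _, inf_le_right⟩, hu'J⟩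
    · have hsum : ∑ i, u i • A i = ∑ i, u' i • A i + ∑ i, (u i - u' i) • A i := by
        rw [← Finset.sum_add_distrib]
        refine Finset.sum_congr rfl fun i _ => ?_
        rw [← add_smul, Nat.add_sub_cancel' (by simp [hu'])]
      rw [hsum, map_add]
      refine hp u' inf_le_right hu'J _ (castC_mem_complexSpan_of_intSpan (natSpan_le_intSpan
        (sum_smul_mem_natSpan fun i hi => ?_)))
      have hi : ¬ u' i = B := hi
      simp only [hu', Pi.inf_apply] at hi ⊢
      omega
  · rw [map_prod]
    refine Finset.prod_ne_zero_iff.2 fun u hu => ?_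
    simp only [Finset.mem_filter, Finset.mem_Icc] at hu
    exact hp0 u hu.1.2 hu.2

variable (hA : AddSubgroup.closure (Set.range A) = ⊤)

/-- An operator annihilates `L(α)` exactly when its symbols vanish at the weights through which one
can pass from the weight `α` back to itself. -/
theorem mem_annihilator_L_iff {α : Fin d → ℂ} {P : DRA A} :
    P ∈ Module.annihilator (DRA A) (L A α) ↔ ∀ a b : Fin d → ℤ,
      (∀ τ, E A α τ ⊆ E A (α + castC b) τ) → (∀ τ, E A (α + castC b + castC a) τ ⊆ E A α τ) →
        eval (α + castC b) (symb hA a P) = 0 := by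
  have key : ∀ {a b c : Fin d → ℤ} {q r : MvPolynomial (Fin d) ℂ} (_ : c = -(b + a))
      (hq : q ∈ vanish A b) (hr : r ∈ vanish A c),
      eval α (symb hA 0 (mkOp c r hr * (P * mkOp b q hq))) =
        eval (α + castC b + castC a) r * (eval (α + castC b) (symb hA a P) * eval α q) := by
    rintro a b _ q r rfl hq hr
    rw [symb_mkOp_mul, symb_mul_mkOp, map_mul, map_mul, eval_shift, eval_shift]
    simp only [zero_sub, neg_neg, add_sub_cancel_left, map_add, add_assoc]
  rw [mem_annihilator_L hA]
  constructor
  · intro h a b hb ha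
    obtain ⟨q, hq, hqα⟩ := exists_of_E_subset hb
    obtain ⟨r, hr, hrα⟩ := exists_of_E_subset (α := α + castC b + castC a) (b := -(b + a))
      (by
        have : α + castC b + castC a + castC (-(b + a)) = α := by
          rw [map_neg, map_add]; abel
        rwa [this])
    have := h (mkOp b q hq) (mkOp _ r hr)
    rw [key rfl] at this
    simpa [hqα, hrα] using this
  · intro h Q R
    rw [← sum_comp hA Q, ← sum_comp hA R, Finset.mul_sum, Finset.mul_sum, map_sum, map_sum]
    refine Finset.sum_eq_zero fun b _ => ?_
    rw [Finset.sum_mul, map_sum, map_sum]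
    refine Finset.sum_eq_zero fun c _ => ?_
    rw [comp, comp, key (a := -(c + b)) (by abel)]
    by_contra hne
    have hr := left_ne_zero_of_mul hne
    have hq := right_ne_zero_of_mul (right_ne_zero_of_mul hne)
    refine left_ne_zero_of_mul (right_ne_zero_of_mul hne) (h _ _ ?_ ?_)
    · exact E_subset_of_exists (symb_mem_vanish hA Q b) hq
    · have h1 := E_subset_of_exists (symb_mem_vanish hA R c) hr
      have h2 : α + castC b + castC (-(c + b)) + castC c = α := by
        rw [map_neg, map_add]; abel
      rwa [h2] at h1

end Criterion

/-! ### Rational structure of the spans -/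

section Rational

variable {d n : ℕ} {A : Fin n → Fin d → ℤ}

theorem exists_mul_eq_intCast (q : Fin d → ℚ) :
    ∃ k : ℕ, 0 < k ∧ ∃ m : Fin d → ℤ, ∀ j, (k : ℚ) * q j = m j := by
  refine ⟨∏ j, (q j).den, Finset.prod_pos fun j _ => (q j).den_pos, ?_⟩
  choose c hc using fun j => Finset.dvd_prod_of_mem (fun j => (q j).den) (Finset.mem_univ j)
  refine ⟨fun j => c j * (q j).num, fun j => ?_⟩
  rw [hc j]
  push_cast
  rw [mul_comm ((q j).den : ℚ), mul_assoc, Rat.den_mul_eq_num]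

theorem map_intCast_mul (φ : ℂ →ₗ[ℚ] ℚ) (k : ℤ) (c : ℂ) : φ (c * k) = k * φ c := by
  rw [mul_comm, ← zsmul_eq_mul, map_zsmul, zsmul_eq_mul]

/-- Applying a `ℚ`-linear functional to the coordinates carries `ℂτ` into `ℚτ`. -/
theorem exists_mul_eq_of_mem_complexSpan (φ : ℂ →ₗ[ℚ] ℚ) {τ : Set (Fin n)} {x : Fin d → ℂ}
    (hx : x ∈ complexSpan A τ) :
    ∃ k : ℕ, 0 < k ∧ ∃ z ∈ intSpan A τ, ∀ j, (k : ℚ) * φ (x j) = z j := by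
  induction hx using Submodule.closure_induction with
  | zero => exact ⟨1, one_pos, 0, zero_mem _, by simp⟩
  | add x y _ _ hx hy =>
    obtain ⟨k, hk, z, hz, hxz⟩ := hx
    obtain ⟨l, hl, w, hw, hyw⟩ := hy
    refine ⟨k * l, Nat.mul_pos hk hl, l • z + k • w, add_mem (nsmul_mem hz _) (nsmul_mem hw _),
      fun j => ?_⟩
    simp only [Pi.add_apply, map_add, Pi.smul_apply]
    simp only [nsmul_eq_mul]
    push_cast
    rw [← hxz, ← hyw]
    ring
  | smul_mem c x hx =>
    obtain ⟨i, hi, rfl⟩ := hx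
    refine ⟨(φ c).den, (φ c).den_pos, (φ c).num • A i,
      zsmul_mem (AddSubgroup.subset_closure (Set.mem_image_of_mem _ hi)) _, fun j => ?_⟩
    simp only [Pi.smul_apply, smul_eq_mul, castC_apply, map_intCast_mul]
    push_cast
    rw [← Rat.den_mul_eq_num]
    ring

theorem exists_rat_retraction : ∃ φ : ℂ →ₗ[ℚ] ℚ, ∀ k : ℤ, φ k = k := by
  obtain ⟨φ, hφ⟩ := LinearMap.exists_leftInverse_of_injective (Algebra.linearMap ℚ ℂ)
    (LinearMap.ker_eq_bot.2 (algebraMap ℚ ℂ).injective)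
  refine ⟨φ, fun k => ?_⟩
  have := LinearMap.congr_fun hφ k
  simpa using this

variable (A) in
/-- The intersection of the spaces `ℂτ` over a family of sets `τ`. -/
def spanInf (T : Set (Set (Fin n))) : Submodule ℂ (Fin d → ℂ) := ⨅ τ ∈ T, complexSpan A τ

variable (A) in
/-- The intersection of the groups `ℤτ` over a family of sets `τ`. -/
def latticeInf (T : Set (Set (Fin n))) : AddSubgroup (Fin d → ℤ) := ⨅ τ ∈ T, intSpan A τ

theorem mem_spanInf {T : Set (Set (Fin n))} {x : Fin d → ℂ} :
    x ∈ spanInf A T ↔ ∀ τ ∈ T, x ∈ complexSpan A τ := by simp [spanInf]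

theorem mem_latticeInf {T : Set (Set (Fin n))} {x : Fin d → ℤ} :
    x ∈ latticeInf A T ↔ ∀ τ ∈ T, x ∈ intSpan A τ := by simp [latticeInf, AddSubgroup.mem_iInf]

theorem exists_mul_eq_of_mem_spanInf (φ : ℂ →ₗ[ℚ] ℚ) {T : Set (Set (Fin n))} {x : Fin d → ℂ}
    (hx : x ∈ spanInf A T) :
    ∃ k : ℕ, 0 < k ∧ ∃ z ∈ latticeInf A T, ∀ j, (k : ℚ) * φ (x j) = z j := by
  classical
  have h1 : ∀ τ : Set (Fin n), ∃ k : ℕ, 0 < k ∧ (τ ∈ T → ∃ z ∈ intSpan A τ,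
      ∀ j, (k : ℚ) * φ (x j) = z j) := by
    intro τ
    by_cases hτ : τ ∈ T
    · obtain ⟨k, hk, hz⟩ := exists_mul_eq_of_mem_complexSpan φ (mem_spanInf.1 hx τ hτ)
      exact ⟨k, hk, fun _ => hz⟩
    · exact ⟨1, one_pos, fun h => absurd h hτ⟩
  choose k hk hz using h1
  obtain ⟨l, hl, m, hm⟩ := exists_mul_eq_intCast fun j => φ (x j)
  refine ⟨l * ∏ τ, k τ, Nat.mul_pos hl (Finset.prod_pos fun τ _ => hk τ), (∏ τ, k τ) • m,
    mem_latticeInf.2 fun τ hτ => ?_, fun j => ?_⟩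
  · obtain ⟨z, hz, hxz⟩ := hz τ hτ
    obtain ⟨c, hc⟩ := Finset.dvd_prod_of_mem k (Finset.mem_univ τ)
    have : (∏ τ, k τ) • m = (c * l) • z := by
      funext j
      have : (((∏ τ, k τ) • m) j : ℚ) = (((c * l) • z) j : ℚ) := by
        simp only [Pi.smul_apply, nsmul_eq_mul]
        push_cast
        rw [← hm, ← hxz, ← Nat.cast_prod, hc]
        push_cast
        ring
      exact_mod_cast this
    rw [this]
    exact nsmul_mem hz _
  · simp only [Pi.smul_apply, nsmul_eq_mul]
    push_cast
    rw [← hm]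
    ring

/-- The lattice `⋂ ℤτ` spans `⋂ ℂτ`: expand the coordinates in a basis of `ℂ` over `ℚ`. -/
theorem spanInf_le_span_latticeInf (T : Set (Set (Fin n))) :
    spanInf A T ≤ Submodule.span ℂ
      (((latticeInf A T).toAddSubmonoid.map (castC (d := d)) : AddSubmonoid (Fin d → ℂ)) :
        Set (Fin d → ℂ)) := by
  classical
  intro x hx
  set B := Module.Basis.ofVectorSpace ℚ ℂ with hB
  choose k hk z hz hxz using fun i => exists_mul_eq_of_mem_spanInf (B.coord i) hx
  set F := Finset.univ.biUnion fun j => (B.repr (x j)).support with hF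
  have hsum : x = ∑ i ∈ F, (B i * (k i : ℂ)⁻¹) • castC (z i) := by
    funext j
    have h1 : x j = ∑ i ∈ F, B.repr (x j) i • B i := by
      conv_lhs => rw [← B.linearCombination_repr (x j), Finsupp.linearCombination_apply]
      refine Finsupp.sum_of_support_subset _ ?_ _ (by simp)
      exact Finset.subset_biUnion_of_mem (fun j => (B.repr (x j)).support) (Finset.mem_univ j)
    rw [Finset.sum_apply]
    refine h1.trans (Finset.sum_congr rfl fun i _ => ?_)
    have h2 := congrArg (Rat.cast : ℚ → ℂ) (hxz i j)
    rw [Module.Basis.coord_apply] at h2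
    push_cast at h2
    have h3 : (k i : ℂ) ≠ 0 := by exact_mod_cast (hk i).ne'
    rw [Pi.smul_apply, castC_apply, ← h2, Rat.smul_def, smul_eq_mul]
    field_simp
  rw [hsum]
  exact sum_mem fun i _ => Submodule.smul_mem _ _
    (Submodule.subset_span (AddSubmonoid.mem_map_of_mem _ (hz i)))

theorem exists_nsmul_mem_intSpan {τ : Set (Fin n)} {x : Fin d → ℤ}
    (hx : castC x ∈ complexSpan A τ) : ∃ k : ℕ, 0 < k ∧ k • x ∈ intSpan A τ := by
  obtain ⟨φ, hφ⟩ := exists_rat_retraction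
  obtain ⟨k, hk, z, hz, hxz⟩ := exists_mul_eq_of_mem_complexSpan φ hx
  refine ⟨k, hk, ?_⟩
  convert hz using 1
  funext j
  have := hxz j
  rw [castC_apply, hφ] at this
  simp only [Pi.smul_apply, nsmul_eq_mul]
  exact_mod_cast this

/-- A point congruent to integral points modulo each of the `ℂτ` is, up to a multiple, congruent to
a single integral point modulo `⋂ ℂτ`. -/
theorem exists_nsmul_sub_mem_spanInf {T : Set (Set (Fin n))} {α : Fin d → ℂ}
    (hα : ∀ τ ∈ T, ∃ m : Fin d → ℤ, α - castC m ∈ complexSpan A τ) :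
    ∃ k : ℕ, 0 < k ∧ ∃ m : Fin d → ℤ, k • α - castC m ∈ spanInf A T := by
  obtain ⟨φ, hφ⟩ := exists_rat_retraction
  obtain ⟨k, hk, m, hm⟩ := exists_mul_eq_intCast fun j => φ (α j)
  refine ⟨k, hk, m, mem_spanInf.2 fun τ hτ => ?_⟩
  obtain ⟨a, ha⟩ := hα τ hτ
  obtain ⟨l, hl, z, hz, hcz⟩ := exists_mul_eq_of_mem_complexSpan φ ha
  have hl' : (l : ℂ) ≠ 0 := by exact_mod_cast hl.ne'
  have : k • α - castC m = (k : ℂ) • ((α - castC a) - (l : ℂ)⁻¹ • castC z) := by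
    funext j
    have h1 : ((k : ℚ) : ℂ) * (φ (α j) : ℂ) = (m j : ℂ) := by exact_mod_cast hm j
    have h2 : ((l : ℚ) : ℂ) * ((φ (α j) : ℂ) - (a j : ℂ)) = (z j : ℂ) := by
      have := hcz j
      rw [Pi.sub_apply, castC_apply, map_sub, hφ] at this
      exact_mod_cast this
    push_cast at h1 h2
    simp only [Pi.sub_apply, Pi.smul_apply, castC_apply, smul_eq_mul]
    rw [nsmul_eq_mul]
    rw [← h1, ← h2]
    field_simp
    ring
  rw [this]
  exact Submodule.smul_mem _ _ (sub_mem ha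
    (Submodule.smul_mem _ _ (castC_mem_complexSpan_of_intSpan hz)))

/-- In the image of a finitely generated abelian group, only finitely many classes modulo a subgroup
are torsion. -/
theorem finite_image_mk_of_torsion {X V : Type*} [AddCommGroup X] [Module.Finite ℤ X]
    [AddCommGroup V] (g : X →+ V) (H : AddSubgroup V) {S : Set V} (hS : ∀ v ∈ S, v ∈ g.range)
    (ht : ∀ v ∈ S, ∃ k : ℕ, 0 < k ∧ k • v ∈ H) :
    ((QuotientAddGroup.mk : V → V ⧸ H) '' S).Finite := by
  set R := LinearMap.range ((QuotientAddGroup.mk' H).comp g).toIntLinearMap with hR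
  have hfin : Finite (Submodule.torsion ℤ R) := by
    have : Module.Finite ℤ R := inferInstance
    have := Submodule.torsion_isTorsion (R := ℤ) (M := R)
    exact Module.finite_of_fg_torsion _ this
  refine (Set.finite_range fun x : Submodule.torsion ℤ R => ((x : R) : V ⧸ H)).subset ?_
  rintro _ ⟨v, hv, rfl⟩
  obtain ⟨x, rfl⟩ := hS v hv
  obtain ⟨k, hk, hkv⟩ := ht _ hv
  refine ⟨⟨⟨_, x, rfl⟩, ?_⟩, rfl⟩
  rw [Submodule.mem_torsion_iff]
  refine ⟨⟨k, mem_nonZeroDivisors_of_ne_zero (by exact_mod_cast hk.ne')⟩, Subtype.ext ?_⟩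
  change (k : ℤ) • (QuotientAddGroup.mk (g x) : V ⧸ H) = 0
  rw [natCast_zsmul, ← QuotientAddGroup.mk_nsmul, QuotientAddGroup.eq_zero_iff]
  exact hkv

end Rational

/-! ### Finiteness of the set of annihilators -/

section Finiteness

open MvPolynomial

variable {d n : ℕ} {A : Fin n → Fin d → ℤ}

variable (A) in
/-- The sets `τ` for which `α` is congruent to an integral point modulo `ℂτ`. -/
def intFaces (α : Fin d → ℂ) : Set (Set (Fin n)) :=
  {τ | ∃ m : Fin d → ℤ, α - castC m ∈ complexSpan A τ}

theorem intFaces_add_castC (α : Fin d → ℂ) (m : Fin d → ℤ) :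
    intFaces A (α + castC m) = intFaces A α := by
  ext τ
  constructor
  · rintro ⟨a, ha⟩
    refine ⟨a - m, ?_⟩
    convert ha using 1
    rw [map_sub]; abel
  · rintro ⟨a, ha⟩
    refine ⟨a + m, ?_⟩
    convert ha using 1
    rw [map_add]; abel

theorem E_eq_empty {α : Fin d → ℂ} {τ : Set (Fin n)} (h : τ ∉ intFaces A α) : E A α τ = ∅ := by
  refine Set.eq_empty_of_forall_notMem ?_
  rintro l ⟨hl, y, hy, -⟩
  refine h ⟨y, ?_⟩
  rwa [hy, sub_sub_cancel]

theorem exists_sub_of_mem_intSpan {τ : Set (Fin n)} {z : Fin d → ℤ} (hz : z ∈ intSpan A τ) :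
    ∃ v ∈ natSpan A τ, ∃ w ∈ natSpan A τ, z + w = v := by
  induction hz using AddSubgroup.closure_induction with
  | mem x hx => exact ⟨x, AddSubmonoid.subset_closure hx, 0, zero_mem _, add_zero x⟩
  | zero => exact ⟨0, zero_mem _, 0, zero_mem _, add_zero 0⟩
  | add x y _ _ hx hy =>
    obtain ⟨v, hv, w, hw, h⟩ := hx
    obtain ⟨v', hv', w', hw', h'⟩ := hy
    exact ⟨v + v', add_mem hv hv', w + w', add_mem hw hw', by rw [← h, ← h']; abel⟩
  | neg x _ hx =>
    obtain ⟨v, hv, w, hw, h⟩ := hx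
    exact ⟨w, hw, v, hv, by rw [← h]; abel⟩

theorem exists_add_mem_NA_of_intSpan {τ : Set (Fin n)} {y z : Fin d → ℤ} (hz : z ∈ intSpan A τ)
    (hy : ∃ w ∈ natSpan A τ, y + w ∈ NA A) : ∃ w ∈ natSpan A τ, y + z + w ∈ NA A := by
  obtain ⟨w, hw, hyw⟩ := hy
  obtain ⟨v, hv, w', hw', rfl⟩ := exists_sub_of_mem_intSpan hz
  refine ⟨w + w', add_mem hw hw', ?_⟩
  have := add_mem hyw (natSpan_le_NA τ hv)
  convert this using 1
  abel

theorem E_add_intSpan {α : Fin d → ℂ} {τ : Set (Fin n)} {z : Fin d → ℤ} (hz : z ∈ intSpan A τ) :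
    E A (α + castC z) τ = E A α τ := by
  have key : ∀ {α : Fin d → ℂ} {z : Fin d → ℤ}, z ∈ intSpan A τ →
      E A α τ ⊆ E A (α + castC z) τ := by
    rintro α z hz l ⟨hl, y, hy, hyw⟩
    exact ⟨hl, y + z, by rw [map_add, hy]; abel, exists_add_mem_NA_of_intSpan hz hyw⟩
  refine (key hz).antisymm' ?_
  have := key (α := α + castC z) (neg_mem hz)
  rwa [map_neg, add_neg_cancel_right] at this

theorem add_mem_E_of_intSpan {α l : Fin d → ℂ} {τ : Set (Fin n)} {z : Fin d → ℤ}
    (hz : z ∈ intSpan A τ) (hl : l ∈ E A α τ) : l + castC z ∈ E A α τ := by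
  obtain ⟨hl, y, hy, hyw⟩ := hl
  refine ⟨add_mem hl (castC_mem_complexSpan_of_intSpan hz), y - z, by rw [map_sub, hy]; abel, ?_⟩
  rw [sub_eq_add_neg]
  exact exists_add_mem_NA_of_intSpan (neg_mem hz) hyw

theorem add_mem_E_add_iff {α l w : Fin d → ℂ} {τ : Set (Fin n)} (hw : w ∈ complexSpan A τ) :
    l + w ∈ E A (α + w) τ ↔ l ∈ E A α τ := by
  simp only [E, Set.mem_ofPred_eq, add_sub_add_right_eq_sub]
  rw [Submodule.add_mem_iff_left _ hw]

/-- On a coset of `ℤ^d` the function `E` takes finitely many values: the sets `E_τ` are unions of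
classes modulo `ℤτ`, contained in a fixed set that is finite modulo `ℤτ`. -/
theorem finite_range_E (α : Fin d → ℂ) :
    (Set.range fun m : Fin d → ℤ => E A (α + castC m)).Finite := by
  have hτ : ∀ τ, (Set.range fun m : Fin d → ℤ => E A (α + castC m) τ).Finite := by
    intro τ
    set H : AddSubgroup (Fin d → ℂ) := (intSpan A τ).map castC with hH
    set K : Set (Fin d → ℂ) := {l | l ∈ complexSpan A τ ∧ ∃ y : Fin d → ℤ, castC y = α - l}
    have hK : ((QuotientAddGroup.mk : _ → (Fin d → ℂ) ⧸ H) '' K).Finite := by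
      rcases K.eq_empty_or_nonempty with h | ⟨l₀, hl₀, y₀, hy₀⟩
      · rw [h, Set.image_empty]; exact Set.finite_empty
      have h1 := finite_image_mk_of_torsion (castC (d := d)) H
        (S := {v | v ∈ complexSpan A τ ∧ v ∈ (castC (d := d)).range}) (fun v hv => hv.2) (by
          rintro _ ⟨hv, y, rfl⟩
          obtain ⟨k, hk, hky⟩ := exists_nsmul_mem_intSpan hv
          exact ⟨k, hk, k • y, hky, map_nsmul _ _ _⟩)
      refine (h1.image fun c => c + QuotientAddGroup.mk l₀).subset ?_
      rintro _ ⟨l, ⟨hl, y, hy⟩, rfl⟩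
      refine ⟨QuotientAddGroup.mk (l - l₀), ⟨l - l₀, ⟨sub_mem hl hl₀, y₀ - y, ?_⟩, rfl⟩, ?_⟩
      · rw [map_sub, hy, hy₀]; abel
      · beta_reduce
        rw [← QuotientAddGroup.mk_add, sub_add_cancel]
    refine (hK.finite_subsets.image fun S => QuotientAddGroup.mk ⁻¹' S).subset ?_
    rintro _ ⟨m, rfl⟩
    refine ⟨QuotientAddGroup.mk '' E A (α + castC m) τ, ?_, ?_⟩
    · refine Set.image_mono ?_
      rintro l ⟨hl, y, hy, -⟩
      exact ⟨hl, y - m, by rw [map_sub, hy]; abel⟩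
    · refine Set.Subset.antisymm ?_ (Set.subset_preimage_image _ _)
      rintro l ⟨l', hl', hll'⟩
      rw [QuotientAddGroup.eq] at hll'
      obtain ⟨z, hz, hzl⟩ := hll'
      have := add_mem_E_of_intSpan hz hl'
      rwa [hzl, add_neg_cancel_left] at this
  refine (Set.Finite.pi hτ).subset ?_
  rintro _ ⟨m, rfl⟩ τ _
  exact ⟨m, rfl⟩

variable (hA : AddSubgroup.closure (Set.range A) = ⊤)

include hA in
/-- The weights that test membership in the annihilator of `L(α)` depend only on the coset `α + ℤ^d`
and on `E(α)`. -/
theorem annihilator_L_add_castC {α : Fin d → ℂ} {m : Fin d → ℤ} (h : E A (α + castC m) = E A α) :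
    Module.annihilator (DRA A) (L A (α + castC m)) = Module.annihilator (DRA A) (L A α) := by
  have key : ∀ {α : Fin d → ℂ} {m : Fin d → ℤ}, E A (α + castC m) = E A α →
      Module.annihilator (DRA A) (L A α) ≤ Module.annihilator (DRA A) (L A (α + castC m)) := by
    intro α m h P hP
    rw [mem_annihilator_L_iff hA] at hP ⊢
    intro a b hb ha
    have := hP a (m + b)
    rw [map_add, ← add_assoc, ← h] at this
    exact this hb ha
  refine (key h).antisymm' ?_
  have := key (α := α + castC m) (m := -m)
  rw [map_neg, add_neg_cancel_right] at this
  exact this h.symm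

include hA in
/-- Translation of `α` by `⋂ ℂτ`, over all `τ` with `α ∈ ℤ^d + ℂτ`, does not change the annihilator
of `L(α)`, as long as it does not enlarge this set of `τ`: the weights testing membership in the
annihilator form a set invariant under `⋂ ℤτ`, which is Zariski dense in `⋂ ℂτ`. -/
theorem annihilator_L_add_spanInf {α w : Fin d → ℂ} (hT : intFaces A (α + w) = intFaces A α)
    (hw : w ∈ spanInf A (intFaces A α)) :
    Module.annihilator (DRA A) (L A (α + w)) = Module.annihilator (DRA A) (L A α) := by
  have key : ∀ {α w : Fin d → ℂ}, intFaces A (α + w) = intFaces A α →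
      w ∈ spanInf A (intFaces A α) →
      Module.annihilator (DRA A) (L A α) ≤ Module.annihilator (DRA A) (L A (α + w)) := by
    intro α w hT hw P hP
    rw [mem_annihilator_L_iff hA] at hP ⊢
    intro a b hb ha
    have hsub : ∀ (x x' : Fin d → ℤ) (τ : Set (Fin n)),
        E A (α + w + castC x) τ ⊆ E A (α + w + castC x') τ →
          E A (α + castC x) τ ⊆ E A (α + castC x') τ := by
      intro x x' τ h
      by_cases hτ : τ ∈ intFaces A α
      · have hwτ := mem_spanInf.1 hw τ hτ
        intro l hl
        rw [← add_mem_E_add_iff hwτ, add_right_comm] at hl ⊢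
        exact h hl
      · rw [E_eq_empty]
        · exact Set.empty_subset _
        · rwa [intFaces_add_castC]
    have hG : ∀ (x : Fin d → ℤ) {z : Fin d → ℤ} (_ : z ∈ latticeInf A (intFaces A α)) τ,
        E A (α + castC x + castC z) τ = E A (α + castC x) τ := by
      intro x z hz τ
      by_cases hτ : τ ∈ intFaces A α
      · exact E_add_intSpan (mem_latticeInf.1 hz τ hτ)
      · rw [E_eq_empty, E_eq_empty]
        · rwa [intFaces_add_castC]
        · rwa [intFaces_add_castC, intFaces_add_castC]
    rw [add_right_comm]
    refine eval_add_eq_zero_of_mem_span ((latticeInf A (intFaces A α)).toAddSubmonoid.map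
      (castC (d := d))) ?_ (spanInf_le_span_latticeInf _ hw)
    rintro _ ⟨z, hz, rfl⟩
    rw [add_assoc, ← map_add]
    refine hP a (b + z) (fun τ => ?_) fun τ => ?_
    · rw [map_add, ← add_assoc, hG b hz]
      have := hsub 0 b τ
      simp only [map_zero, add_zero] at this
      exact this (hb τ)
    · have h1 : α + castC (b + z) + castC a = α + castC (b + a) + castC z := by
        rw [map_add, map_add]; abel
      rw [h1, hG _ hz]
      have := hsub (b + a) 0 τ
      simp only [map_zero, add_zero, map_add] at this
      rw [map_add]
      refine this ?_
      rw [← add_assoc]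
      exact ha τ
  refine (key hT hw).antisymm' ?_
  have := key (α := α + w) (w := -w)
  rw [add_neg_cancel_right] at this
  exact this hT.symm (hT ▸ neg_mem hw)

include hA in
/-- The points `α` with a given set `T` of `τ` fall into finitely many classes modulo
`ℤ^d + ⋂ ℂτ`, and each class contributes finitely many annihilators. -/
theorem finite_annihilators_of_intFaces_eq (T : Set (Set (Fin n))) :
    ((fun α => Module.annihilator (DRA A) (L A α)) '' {α | intFaces A α = T}).Finite := by
  classical
  set f : (Fin d → ℂ) →ₗ[ℂ] (∀ τ : T, (Fin d → ℂ) ⧸ complexSpan A τ) :=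
    LinearMap.pi fun τ => (complexSpan A (τ : Set (Fin n))).mkQ with hf
  have hker : ∀ x, f x = 0 ↔ x ∈ spanInf A T := by
    intro x
    rw [mem_spanInf, funext_iff]
    simp [hf]
  set H : AddSubgroup (∀ τ : T, (Fin d → ℂ) ⧸ complexSpan A τ) :=
    (f.toAddMonoidHom.comp castC).range with hH
  let g : (T → Fin d → ℤ) →+ (∀ τ : T, (Fin d → ℂ) ⧸ complexSpan A τ) :=
    { toFun := fun m τ => (complexSpan A (τ : Set (Fin n))).mkQ (castC (m τ))
      map_zero' := by funext τ; simp
      map_add' := by intro m m'; funext τ; simp }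
  set S : Set (Fin d → ℂ) := {α | intFaces A α = T} with hS
  have hfin := finite_image_mk_of_torsion g H (S := f '' S)
    (by
      rintro _ ⟨α, hα, rfl⟩
      choose m hm using fun τ : T => show (τ : Set (Fin n)) ∈ intFaces A α from
        (show intFaces A α = T from hα) ▸ τ.2
      refine ⟨m, funext fun τ => ?_⟩
      exact ((Submodule.Quotient.eq _).2 (hm τ)).symm)
    (by
      rintro _ ⟨α, hα, rfl⟩
      obtain ⟨k, hk, m, hm⟩ := exists_nsmul_sub_mem_spanInf (A := A) (α := α) (T := T)
        fun τ hτ => show τ ∈ intFaces A α from (show intFaces A α = T from hα) ▸ hτ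
      refine ⟨k, hk, m, ?_⟩
      rw [← hker, map_sub, map_nsmul, sub_eq_zero] at hm
      exact hm.symm)
  rw [Set.image_image] at hfin
  set q : (Fin d → ℂ) → (∀ τ : T, (Fin d → ℂ) ⧸ complexSpan A τ) ⧸ H :=
    fun α => QuotientAddGroup.mk (f α) with hq
  refine (hfin.biUnion (t := fun c => (fun α => Module.annihilator (DRA A) (L A α)) ''
    {α | intFaces A α = T ∧ q α = c}) ?_).subset ?_
  · rintro _ ⟨α, hα, rfl⟩
    have h1 : (Set.range fun m : Fin d → ℤ =>
        Module.annihilator (DRA A) (L A (α + castC m))).Finite := by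
      have hfac : Function.FactorsThrough
          (fun m : Fin d → ℤ => Module.annihilator (DRA A) (L A (α + castC m)))
          (fun m => E A (α + castC m)) := by
        intro m m' hmm'
        have h2 : α + castC m = α + castC m' + castC (m - m') := by rw [map_sub]; abel
        have h3 := annihilator_L_add_castC hA (α := α + castC m') (m := m - m')
        rw [← h2] at h3
        exact h3 hmm'
      rw [← hfac.extend_comp (fun _ => ⊤), Set.range_comp]
      exact (finite_range_E α).image _
    refine h1.subset ?_
    rintro _ ⟨β, ⟨hβ, hqβ⟩, rfl⟩
    obtain ⟨m, hm⟩ := QuotientAddGroup.eq.1 hqβ.symm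
    refine ⟨m, ?_⟩
    have hw : β - (α + castC m) ∈ spanInf A T := by
      rw [← hker, map_sub, map_add, ← sub_sub, sub_eq_zero, sub_eq_neg_add]
      exact hm.symm
    have hTα : intFaces A (α + castC m) = T := (intFaces_add_castC α m).trans hα
    have := annihilator_L_add_spanInf hA (α := α + castC m) (w := β - (α + castC m))
      (by rw [add_sub_cancel, hTα, hβ]) (by rwa [hTα])
    rw [add_sub_cancel] at this
    exact this.symm
  · rintro _ ⟨α, hα, rfl⟩
    exact Set.mem_biUnion ⟨α, hα, rfl⟩ ⟨α, ⟨hα, rfl⟩, rfl⟩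

include hA in
theorem finite_range_annihilator_L :
    (Set.range fun α : Fin d → ℂ => Module.annihilator (DRA A) (L A α)).Finite := by
  refine (Set.finite_iUnion fun T => finite_annihilators_of_intFaces_eq hA T).subset ?_
  rintro _ ⟨α, rfl⟩
  exact Set.mem_iUnion.2 ⟨intFaces A α, α, rfl, rfl⟩

end Finiteness

end ToricDiffOp

theorem mainTheorem2 {d n : ℕ} (A : Fin n → Fin d → ℤ)
    (hA : AddSubgroup.closure (Set.range A) = ⊤) :
    ToricDiffOp.Prim A =
        Set.range (fun α : Fin d → ℂ =>
          Module.annihilator (ToricDiffOp.DRA A) (ToricDiffOp.L A α)) ∧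
      (ToricDiffOp.Prim A).Finite := by
  have h : ToricDiffOp.Prim A = Set.range (fun α : Fin d → ℂ =>
      Module.annihilator (ToricDiffOp.DRA A) (ToricDiffOp.L A α)) := by
    ext I
    constructor
    · rintro ⟨N, _, _, 𝓜, hN, rfl⟩
      obtain ⟨α, hα⟩ := ToricDiffOp.exists_annihilator_eq hA hN
      exact ⟨α, hα.symm⟩
    · rintro ⟨α, rfl⟩
      exact ⟨ToricDiffOp.L A α, inferInstance, inferInstance, ToricDiffOp.gradedL A α,
        ToricDiffOp.isGradedSimple_L hA α, rfl⟩
  exact ⟨h, h ▸ ToricDiffOp.finite_range_annihilator_L hA⟩
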